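/- **Setting.** Let $X$ be a real Banach space, $p\ge 2$, $1/p+1/p^*=1$, and assume that $X$ is smooth (every $x\neq0$ has exactly one $x^*\in X^*$ with $\|x^*\|=1$, $\langle x^*,x\rangle=\|x\|$) and $p$-convex, i.e. for some $K>0$ the modulus of convexity satisfies $\delta_X(\tau)=\inf\{1-\tfrac12\|z+w\|:\|z\|=\|w\|=1,\ \|z-w\|\ge\tau\}\ge K\tau^p$ for all $\tau\in(0,2]$. For a real Banach space $Z$ and $1<t<\infty$ the duality map is $$J_t^Z(z)=\{z^*\in Z^*:\ \langle z^*,z\rangle=\|z\|\,\|z^*\|,\ \|z^*\|=\|z\|^{t-1}\};$$ it is single valued for $Z=X$ and for $Z=X^*$. Write $J_p=J_p^X$, and for $Z\in\{X,X^*\}$, with $1/t+1/t^*=1$, let $D_t(z,w)=\frac1{t^*}\|z\|^t+\frac1t\|w\|^t-\langle J^Z_t(z),w\rangle$ be the Bregman distance; $D=D_p$ on $X$. Let $Y_1,\dots,Y_N$ be real Banach spaces, let $Y=Y_1\times\dots\times Y_N$ carry an $\ell^s$ product norm ($1\le s\le\infty$), let $A=(A_1,\dots,A_N):X\to Y$ be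 bounded and linear with adjoint $A^*:Y^*\to X^*$, $L_{\max}=\max_i\|A_i\|$, and let $y=(y_1,\dots,y_N)\in\operatorname{range}(A)$. Let $x^\dagger$ be the minimum norm solution: $Ax^\dagger=y$ and $\|x^\dagger\|=\inf\{\|x\|:Ax=y\}$. For each $i$ let $\jmath_i$ be an arbitrary single-valued selection of the duality map $J_p^{Y_i}$. Let $i_1,i_2,\dots$ be independent random indices, uniformly distributed on $\{1,\dots,N\}$, let $\mu_k>0$ ($k\ge1$) be deterministic step sizes, and let the (deterministic) $x_0\in X$ and the iteration $$x_{k+1}=J_{p^*}^{X^*}\bigl(J_p(x_k)-\mu_{k+1}A_{i_{k+1}}^*\jmath_{i_{k+1}}(A_{i_{k+1}}x_k-y_{i_{k+1}})\bigr),\qquad k=0,1,\dots$$ define $(x_k)$ ($X$ being identified with its canonical image in $X^{**}$). **Theorem.** There are constants $G_{p^*}>0$ such that $$D_{p^*}(z^*,w^*)\le \frac{G_{p^*}}{p^*}\|w^*-z^*\|^{p^*}\qquad\text{for all }z^*,w^*\in X^*. \tag{1}$$ Let $G_{p^*}>0$ be any constant with (1). Suppose that $\sum_{k\ge1}\mu_k=\infty$,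 $\sum_{k\ge1}\mu_k^{p^*}<\infty$, $J_p(x_0)\in\overline{\operatorname{range}(A^*)}$ (norm closure in $X^*$), and $$\mu_k^{p^*-1}\le\frac{p^*}{G_{p^*}L_{\max}^{p^*}}\qquad\text{for all }k\ge1$$ (no restriction if $L_{\max}=0$). Then the expectations below exist and are finite, and $$\lim_{k\to\infty}\mathbb E[D(x_k,x^\dagger)]=0,\qquad \lim_{k\to\infty}\mathbb E\bigl[\|x_k-x^\dagger\|^r\bigr]=0\quad\text{for every real } r \text{ with } 1\le r\le p.$$ If $X$ is in addition uniformly smooth, i.e. $\rho_X(\tau)/\tau\to0$ as $\tau\searrow0$ for $\rho_X(\tau)=\sup\{\tfrac12(\|z+\tau w\|+\|z-\tau w\|)-1:\|z\|=\|w\|=1\}$, then also $$\lim_{k\to\infty}\mathbb E\bigl[\|J_p(x_k)-J_p(x^\dagger)\|^{p^*}\bigr]=0.$$ -/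

import Mathlib

open MeasureTheory ProbabilityTheory Filter Topology

namespace BanachSGD

noncomputable section

section Geometry

variable (X : Type*) [NormedAddCommGroup X] [NormedSpace ℝ X]

/-- `X` is smooth: each nonzero `x` has exactly one norming functional of norm one. -/
def IsSmooth : Prop :=
  ∀ x : X, x ≠ 0 → ∃! f : StrongDual ℝ X, f x = ‖x‖ ∧ ‖f‖ = 1

/-- Modulus of convexity, `δ_X(τ) = inf {1 - ‖z + w‖ / 2 : ‖z‖ = ‖w‖ = 1, ‖z - w‖ ≥ τ}`.
The infimum is taken in the extended reals, so it is `⊤` over the empty set. -/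
def modulusConvexity (τ : ℝ) : EReal :=
  ⨅ (z : X) (w : X) (_ : ‖z‖ = 1 ∧ ‖w‖ = 1 ∧ τ ≤ ‖z - w‖), ((1 - ‖z + w‖ / 2 : ℝ) : EReal)

/-- `X` is `p`-convex (convex of power type `p`). -/
def IsPConvex (p : ℝ) : Prop :=
  ∃ K : ℝ, 0 < K ∧ ∀ τ : ℝ, 0 < τ → τ ≤ 2 → ((K * τ ^ p : ℝ) : EReal) ≤ modulusConvexity X τ

/-- Modulus of smoothness,
`ρ_X(τ) = sup {(‖z + τ w‖ + ‖z - τ w‖) / 2 - 1 : ‖z‖ = ‖w‖ = 1}`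
(for `τ ≥ 0` this is the supremum of a set bounded by `τ`). -/
def modulusSmoothness (τ : ℝ) : ℝ :=
  sSup {s : ℝ | ∃ z w : X, ‖z‖ = 1 ∧ ‖w‖ = 1 ∧ s = (‖z + τ • w‖ + ‖z - τ • w‖) / 2 - 1}

/-- `X` is uniformly smooth: `ρ_X(τ) / τ → 0` as `τ ↘ 0`. -/
def IsUniformlySmooth : Prop :=
  Tendsto (fun τ : ℝ => modulusSmoothness X τ / τ) (𝓝[>] 0) (𝓝 0)

end Geometry

section Duality

variable {X : Type*} [NormedAddCommGroup X] [NormedSpace ℝ X]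

/-- The set-valued duality map of `X` with gauge function `t ↦ t ^ (p - 1)`. -/
def dualityMap (p : ℝ) (x : X) : Set (StrongDual ℝ X) :=
  {f | f x = ‖x‖ * ‖f‖ ∧ ‖x‖ ^ (p - 1) = ‖f‖}

/-- `j` is a single-valued selection of the duality map. -/
def IsDualitySelection (p : ℝ) (j : X → StrongDual ℝ X) : Prop :=
  ∀ x : X, j x ∈ dualityMap p x

/-- The duality map as a function. When the space is smooth and `p > 1`, `dualityMap p x` is a
singleton and `J p x` is its element. -/
def J (p : ℝ) (x : X) : StrongDual ℝ X :=
  Classical.epsilon (fun f => f ∈ dualityMap p x)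

/-- The Bregman distance `D_p(z, w) = ‖z‖ ^ p / p* + ‖w‖ ^ p / p - ⟨J_p z, w⟩`, where
`1 / p* = 1 - 1 / p`. -/
def bregman (p : ℝ) (z w : X) : ℝ :=
  (1 - 1 / p) * ‖z‖ ^ p + 1 / p * ‖w‖ ^ p - J p z w

/-- `G` is an admissible constant `G_{q}` for the dual space (with `q` the conjugate exponent):
`D_q(z*, w*) ≤ (G / q) ‖w* - z*‖ ^ q` on the dual of `X`, the Bregman distance being that
of the Banach space `StrongDual ℝ X`. -/
def IsDualSmoothnessConst (X : Type*) [NormedAddCommGroup X] [NormedSpace ℝ X]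
    (q G : ℝ) : Prop :=
  0 < G ∧ ∀ z w : StrongDual ℝ X, bregman q z w ≤ G / q * ‖w - z‖ ^ q

end Duality

section Operator

variable {X Y : Type*} [NormedAddCommGroup X] [NormedSpace ℝ X]
  [NormedAddCommGroup Y] [NormedSpace ℝ Y]

/-- The Banach space adjoint `A* : Y* → X*`, `A* f = f ∘ A`. -/
def adjointMap (A : X →L[ℝ] Y) (f : StrongDual ℝ Y) : StrongDual ℝ X :=
  f.comp A

/-- `x` is a minimum norm solution of `A x = y`. -/
def IsMinNormSolution (A : X →L[ℝ] Y) (y : Y) (x : X) : Prop :=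
  A x = y ∧ ‖x‖ = sInf {t : ℝ | ∃ u : X, A u = y ∧ t = ‖u‖}

end Operator

section Kaczmarz

variable {X : Type*} [NormedAddCommGroup X] [NormedSpace ℝ X]
  {N : ℕ} {Y : Fin N → Type*} [∀ i, NormedAddCommGroup (Y i)] [∀ i, NormedSpace ℝ (Y i)]
  {s : ENNReal} [Fact (1 ≤ s)]

/-- The `i`-th component `A_i : X → Y_i` of an operator into the `ℓ^s` product of the `Y_i`. -/
def component (A : X →L[ℝ] PiLp s Y) (i : Fin N) : X →L[ℝ] Y i :=
  (PiLp.proj s Y i).comp A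

/-- `L_max = max_i ‖A_i‖`. -/
def Lmax (A : X →L[ℝ] PiLp s Y) : ℝ :=
  ⨆ i : Fin N, ‖component A i‖

/-- The update direction `g(x, y, i) = A_i* j_i (A_i x - y_i)`, where `j_i` is the chosen
selection of the duality map of `Y_i`. -/
def updateDir (A : X →L[ℝ] PiLp s Y) (y : PiLp s Y)
    (j : ∀ i, Y i → StrongDual ℝ (Y i)) (x : X) (i : Fin N) : StrongDual ℝ X :=
  adjointMap (component A i) (j i (component A i x - y i))

/-- The indices are sampled independently and uniformly from the `N` possible values.
Here `idx k` is the index used in the step from `x_k` to `x_{k+1}`. -/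
structure IsUniformSampling {Ω : Type*} [MeasurableSpace Ω] (P : Measure Ω)
    (idx : ℕ → Ω → Fin N) : Prop where
  measurable : ∀ k, Measurable (idx k)
  uniform : ∀ k i, P.real {ω | idx k ω = i} = 1 / (N : ℝ)
  indep : iIndepFun idx P

/-- The process `x` is the stochastic gradient descent started at `x₀`:
`x_{k+1} = J_q^{X*} (J_p(x_k) - μ_{k+1} g(x_k, y, i_{k+1}))`, where `μ k` and `idx k` stand for
`μ_{k+1}` and `i_{k+1}`. The duality map of `X*` takes values in the bidual, in which `X` is
embedded canonically; if `X` is `p`-convex, it is single valued with values in `X`. -/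
structure IsSGD {Ω : Type*} (p q : ℝ) (A : X →L[ℝ] PiLp s Y) (y : PiLp s Y)
    (j : ∀ i, Y i → StrongDual ℝ (Y i)) (μ : ℕ → ℝ) (idx : ℕ → Ω → Fin N) (x₀ : X)
    (x : ℕ → Ω → X) : Prop where
  init : ∀ ω, x 0 ω = x₀
  step : ∀ k ω, NormedSpace.inclusionInDoubleDual ℝ X (x (k + 1) ω) ∈
    dualityMap q (J p (x k ω) - μ k • updateDir A y j (x k ω) (idx k ω))

end Kaczmarz

end

end BanachSGD

/-!
Write `f = ‖·‖ ^ p / p` on `X`, `z_k = J_p x_k`, and let `S x = ∑ i, ‖A_i x - y_i‖ ^ p` be the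
residual sum. The proof needs neither reflexivity of `X` nor weak compactness.

*Geometry.* A modulus of convexity of power type `p` makes `‖·‖ ^ p` uniformly convex at midpoints
(`IsPConvex.exists_midpointConvexityConst`). This gives the lower bound
`D_p(z, w) ≥ c' ‖z - w‖ ^ p` and, by conjugation, the smoothness constant of the dual
(`IsMidpointConvexityConst.exists_dualSmoothnessConst`). Given any such constant, `J_q` on the dual
is single valued and inverts `J_p`, so that `z_{k+1} = z_k - μ_k g_k` exactly.

*Descent.* On the dual side, `D(x_k, x†) = ‖z_k‖ ^ q / q + f(x†) - ⟨z_k, x†⟩`, and the smoothness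
inequality shows that `D(x_k, x†)` decreases along every path by a multiple of the current residual
(`IsSGD.bregman_succ_le`). Hence all iterates lie in one ball. Since the index of a step is uniform
and independent of the iterate, taking expectations gives `∑ μ_k E[S(x_k)] < ∞`.

*Convergence.* Decompose, for `m ≤ n`,
`D(x_n, x†) = (f(x†) - f(x_n)) + ⟨z_n - z_m, x_n - x†⟩ + ⟨z_m, x_n - x†⟩`.
* By uniform convexity and minimality of `x†`, an approximate solution cannot have norm much
  smaller than `x†`, so the first term is at most `ε + C S(x_n)`
  (`IsMinNormSolution.norm_rpow_le_of_residual_le`).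
* The second is at most `∑ μ_l (‖residual_l‖ ^ p + S(x_n))` over `m ≤ l < n`. If `n` is the first
  index from `m` on at which `E[S(x_n)]` falls below a threshold, then `E[S(x_n)] ≤ E[S(x_l)]` for
  these `l`, and the expectation is at most twice a tail of the convergent series.
* As `z_m` stays in the closure of the range of the adjoint, the third is at most
  `ε ‖x_n - x†‖ + C_m ‖A x_n - y‖` (`IsSGD.exists_abs_J_apply_le`).

So `E[D(x_n, x†)]` is small for some `n`, and it is nonincreasing in `n`. The moments of
`‖x_k - x†‖` follow from the lower bound on the Bregman distance, and the statement on `J_p` from the norm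
continuity of `J_p` in a uniformly smooth space (`IsUniformlySmooth.continuous_J`).
-/

namespace BanachSGD

/-! ### Uniform convexity of the power of the norm -/

section UniformConvexity

/-- Clarkson's inequality for nonnegative reals. -/
lemma clarkson_real {p a b : ℝ} (hp : 2 ≤ p) (ha : 0 ≤ a) (hb : 0 ≤ b) :
    ((a + b) / 2) ^ p + (|a - b| / 2) ^ p ≤ (a ^ p + b ^ p) / 2 := by
  have sq_rpow : ∀ u : ℝ, 0 ≤ u → u ^ p = (u ^ 2) ^ (p / 2) := fun u hu => by
    rw [← Real.rpow_natCast u 2, ← Real.rpow_mul hu]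
    congr 1
    push_cast
    ring
  have hp' : 1 ≤ p / 2 := by linarith
  have h1 := Real.add_rpow_le_rpow_add (sq_nonneg ((a + b) / 2)) (sq_nonneg (|a - b| / 2)) hp'
  have h2 := (convexOn_rpow hp').2 (sq_nonneg a) (sq_nonneg b) (by norm_num : (0 : ℝ) ≤ 1 / 2)
    (by norm_num : (0 : ℝ) ≤ 1 / 2) (by norm_num)
  have h3 : ((a + b) / 2) ^ 2 + (|a - b| / 2) ^ 2
      = (1 / 2 : ℝ) • a ^ 2 + (1 / 2 : ℝ) • b ^ 2 := by
    rw [div_pow |a - b|, sq_abs]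
    simp only [smul_eq_mul]
    ring
  rw [sq_rpow _ (by positivity), sq_rpow _ (by positivity), sq_rpow a ha, sq_rpow b hb]
  rw [h3] at h1
  simp only [smul_eq_mul] at h1 h2
  linarith

lemma norm_add_le_of_isPConvex {X : Type*} [NormedAddCommGroup X] {p K : ℝ} (hp : 2 ≤ p)
    (hK : ∀ τ : ℝ, 0 < τ → τ ≤ 2 → ((K * τ ^ p : ℝ) : EReal) ≤ modulusConvexity X τ)
    {z w : X} (hz : ‖z‖ = 1) (hw : ‖w‖ = 1) : K * ‖z - w‖ ^ p ≤ 1 - ‖z + w‖ / 2 := by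
  rcases eq_or_lt_of_le (norm_nonneg (z - w)) with h | h
  · rw [← h, Real.zero_rpow (by linarith)]
    have := norm_add_le z w
    linarith
  · have h2 : ‖z - w‖ ≤ 2 := (norm_sub_le z w).trans (by linarith)
    have h3 := (hK _ h h2).trans
      (iInf_le_of_le z (iInf_le_of_le w (iInf_le_of_le ⟨hz, hw, le_rfl⟩ le_rfl)))
    exact_mod_cast h3

variable {X : Type*} [NormedAddCommGroup X] [NormedSpace ℝ X]

/-- `c` is a constant of uniform convexity, at midpoints, of the function `‖·‖ ^ p` on `X`. -/
def IsMidpointConvexityConst (X : Type*) [NormedAddCommGroup X] [NormedSpace ℝ X]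
    (p c : ℝ) : Prop :=
  0 < c ∧ ∀ x y : X, ‖(1 / 2 : ℝ) • (x + y)‖ ^ p ≤ (‖x‖ ^ p + ‖y‖ ^ p) / 2 - c * ‖x - y‖ ^ p

lemma midpoint_convexity_of_norm_eq_one {p K : ℝ} (hp : 2 ≤ p) (hK0 : 0 < K)
    (hK : ∀ z w : X, ‖z‖ = 1 → ‖w‖ = 1 → K * ‖z - w‖ ^ p ≤ 1 - ‖z + w‖ / 2)
    {x y : X} (hx : ‖x‖ = 1) (hy : ‖y‖ ≤ 1) :
    ‖(1 / 2 : ℝ) • (x + y)‖ ^ p ≤ (1 + ‖y‖ ^ p) / 2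
      - min ((1 / 8) ^ p) ((1 / 2) ^ (p - 1) * (K / 2 * (3 / 4) ^ p)) * ‖x - y‖ ^ p := by
  set t := ‖y‖ with ht
  set τ := ‖x - y‖ with hτ
  have ht0 : 0 ≤ t := norm_nonneg y
  have hτ0 : 0 ≤ τ := norm_nonneg _
  have hp0 : 0 ≤ p := by linarith
  have hτp : 0 ≤ τ ^ p := by positivity
  have hτ2 : τ ≤ 1 + t := by rw [hτ, ht, ← hx]; exact norm_sub_le x y
  have hcl := clarkson_real hp zero_le_one ht0
  rw [Real.one_rpow, abs_of_nonneg (by linarith)] at hcl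
  have hnorm : ‖(1 / 2 : ℝ) • (x + y)‖ = ‖x + y‖ / 2 := by
    rw [norm_smul, Real.norm_of_nonneg (by norm_num)]
    ring
  rw [hnorm]
  rcases le_or_gt (τ / 4) (1 - t) with h | h
  -- The norms differ by a fixed fraction of the distance: convexity of `s ↦ s ^ p` suffices.
  · have h1 : ‖x + y‖ / 2 ≤ (1 + t) / 2 := by
      have := norm_add_le x y
      rw [hx] at this
      linarith
    have h2 := Real.rpow_le_rpow (by positivity) h1 hp0
    have h3 : (1 / 8 : ℝ) ^ p * τ ^ p ≤ ((1 - t) / 2) ^ p := by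
      rw [← Real.mul_rpow (by norm_num) hτ0]
      exact Real.rpow_le_rpow (by positivity) (by linarith) hp0
    have h4 := mul_le_mul_of_nonneg_right
      (min_le_left ((1 / 8 : ℝ) ^ p) ((1 / 2) ^ (p - 1) * (K / 2 * (3 / 4) ^ p))) hτp
    linarith
  -- The norms are comparable: normalize `y` and use the modulus of convexity.
  · have htpos : 1 / 2 ≤ t := by linarith
    have htne : t ≠ 0 := by linarith
    set w : X := t⁻¹ • y with hw
    have hyw : y = t • w := by rw [hw, smul_smul, mul_inv_cancel₀ htne, one_smul]
    have hw1 : ‖w‖ = 1 := by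
      rw [hw, norm_smul, norm_inv, Real.norm_of_nonneg ht0, ← ht, inv_mul_cancel₀ htne]
    have hxw : 3 / 4 * τ ≤ ‖x - w‖ := by
      have h1 : ‖w - y‖ = 1 - t := by
        have : w - y = (1 - t) • w := by rw [sub_smul, one_smul, ← hyw]
        rw [this, norm_smul, hw1, Real.norm_of_nonneg (by linarith), mul_one]
      have h2 : τ ≤ ‖x - w‖ + ‖w - y‖ := by
        rw [hτ]
        exact norm_sub_le_norm_sub_add_norm_sub x w y
      linarith
    have h1 := hK x w hx hw1
    have h2 : (3 / 4 : ℝ) ^ p * τ ^ p ≤ ‖x - w‖ ^ p := by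
      rw [← Real.mul_rpow (by norm_num) hτ0]
      exact Real.rpow_le_rpow (by positivity) hxw hp0
    set σ := (3 / 4 : ℝ) ^ p * τ ^ p with hσ
    have hσ0 : 0 ≤ σ := by positivity
    have h3 : K * σ ≤ 1 - ‖x + w‖ / 2 := le_trans (by gcongr) h1
    have h4 : ‖x + y‖ ≤ t * ‖x + w‖ + (1 - t) := by
      have : x + y = t • (x + w) + (1 - t) • x := by
        rw [hyw]
        module
      rw [this]
      refine (norm_add_le _ _).trans ?_
      rw [norm_smul, norm_smul, hx, Real.norm_of_nonneg ht0, Real.norm_of_nonneg (by linarith)]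
      linarith
    set a := (1 + t) / 2 with ha
    have ha1 : 1 / 2 ≤ a := by linarith
    have h5 : ‖x + y‖ / 2 ≤ a - K / 2 * σ := by
      have e1 : t * (K * σ) ≤ t * (1 - ‖x + w‖ / 2) := by gcongr
      have e2 : 1 / 2 * (K * σ) ≤ t * (K * σ) := by gcongr
      linarith
    have h6 : (‖x + y‖ / 2) ^ p ≤ a ^ p - (1 / 2) ^ (p - 1) * (K / 2 * σ) := by
      have e0 : 0 ≤ ‖x + y‖ / 2 := by positivity
      have e1 : ∀ u : ℝ, 0 ≤ u → u ^ p = u ^ (p - 1) * u := fun u hu => by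
        rw [← Real.rpow_add_one' hu (by linarith), sub_add_cancel]
      calc (‖x + y‖ / 2) ^ p = (‖x + y‖ / 2) ^ (p - 1) * (‖x + y‖ / 2) := e1 _ e0
        _ ≤ a ^ (p - 1) * (a - K / 2 * σ) := by
            have : ‖x + y‖ / 2 ≤ a := h5.trans (by
              have : 0 ≤ K / 2 * σ := by positivity
              linarith)
            have := Real.rpow_le_rpow e0 this (by linarith : 0 ≤ p - 1)
            exact mul_le_mul this h5 e0 (by positivity)
        _ = a ^ p - a ^ (p - 1) * (K / 2 * σ) := by rw [e1 a (by linarith)]; ring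
        _ ≤ _ := by gcongr; linarith
    have h7 : a ^ p ≤ (1 + t ^ p) / 2 := by
      have : 0 ≤ ((1 - t) / 2) ^ p := Real.rpow_nonneg (by linarith) p
      linarith
    have h8 := mul_le_mul_of_nonneg_right
      (min_le_right ((1 / 8 : ℝ) ^ p) ((1 / 2) ^ (p - 1) * (K / 2 * (3 / 4) ^ p))) hτp
    have h9 : (1 / 2 : ℝ) ^ (p - 1) * (K / 2 * (3 / 4) ^ p) * τ ^ p
        = (1 / 2) ^ (p - 1) * (K / 2 * σ) := by rw [hσ]; ring
    linarith

/-- A modulus of convexity of power type `p` makes `‖·‖ ^ p` uniformly convex, on all of `X` and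
not only on the unit sphere. -/
theorem IsPConvex.exists_midpointConvexityConst {p : ℝ} (hp : 2 ≤ p) (h : IsPConvex X p) :
    ∃ c, IsMidpointConvexityConst X p c := by
  obtain ⟨K, hK0, hK⟩ := h
  refine ⟨min ((1 / 8) ^ p) ((1 / 2) ^ (p - 1) * (K / 2 * (3 / 4) ^ p)), by positivity, ?_⟩
  have key : ∀ x y : X, ‖y‖ ≤ ‖x‖ → ‖(1 / 2 : ℝ) • (x + y)‖ ^ p ≤ (‖x‖ ^ p + ‖y‖ ^ p) / 2
      - min ((1 / 8) ^ p) ((1 / 2) ^ (p - 1) * (K / 2 * (3 / 4) ^ p)) * ‖x - y‖ ^ p := by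
    intro x y hxy
    rcases eq_or_ne x 0 with rfl | hx
    · have : y = 0 := by simpa using hxy
      simp [this, Real.zero_rpow (by linarith : p ≠ 0)]
    · have hr : 0 < ‖x‖ := norm_pos_iff.2 hx
      have scale : ∀ u : X, ‖‖x‖⁻¹ • u‖ = ‖x‖⁻¹ * ‖u‖ := fun u => by
        rw [norm_smul, norm_inv, norm_norm]
      have := midpoint_convexity_of_norm_eq_one hp hK0
        (fun z w hz hw => norm_add_le_of_isPConvex hp hK hz hw)
        (x := ‖x‖⁻¹ • x) (y := ‖x‖⁻¹ • y) (by rw [scale, inv_mul_cancel₀ hr.ne'])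
        (by rw [scale, inv_mul_le_iff₀ hr]; linarith)
      rw [← smul_add, smul_comm, scale, ← smul_sub, scale, scale,
        Real.mul_rpow (by positivity) (by positivity),
        Real.mul_rpow (by positivity) (by positivity),
        Real.mul_rpow (by positivity) (by positivity), Real.inv_rpow hr.le] at this
      have hrp : 0 < ‖x‖ ^ p := by positivity
      have := mul_le_mul_of_nonneg_left this hrp.le
      rw [mul_inv_cancel_left₀ hrp.ne'] at this
      refine this.trans (le_of_eq ?_)
      field_simp
  intro x y
  rcases le_total ‖y‖ ‖x‖ with h | h
  · exact key x y h
  · rw [add_comm x y, add_comm (‖x‖ ^ p), norm_sub_rev]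
    exact key y x h

/-- In a uniformly convex Banach space, the norms of approximate solutions of `A x = y` are
asymptotically at least the norm of the minimum norm solution: near-minimizers of the norm over
the decreasing sets `{x | ‖A x - y‖ ≤ 1 / (n + 1)}` form a Cauchy sequence. -/
theorem IsMinNormSolution.norm_rpow_le_of_residual_le [CompleteSpace X] {Y : Type*}
    [NormedAddCommGroup Y] [NormedSpace ℝ Y] {A : X →L[ℝ] Y} {y : Y} {xd : X}
    (h : IsMinNormSolution A y xd) {p c : ℝ} (hp : 2 ≤ p) (hc : IsMidpointConvexityConst X p c)
    {ε : ℝ} (hε : 0 < ε) :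
    ∃ δ > 0, ∀ x, ‖A x - y‖ ≤ δ → ‖xd‖ ^ p ≤ ‖x‖ ^ p + ε := by
  by_contra! hcon
  have hp0 : 0 < p := by linarith
  let S : ℕ → Set X := fun n => {x | ‖A x - y‖ ≤ 1 / ((n : ℝ) + 1)}
  have hS : ∀ {m n : ℕ}, m ≤ n → S n ⊆ S m := fun {m n} hmn x hx =>
    (show ‖A x - y‖ ≤ 1 / ((n : ℝ) + 1) from hx).trans
      (one_div_le_one_div_of_le (by positivity) (by exact_mod_cast Nat.succ_le_succ hmn))
  let V : ℕ → Set ℝ := fun n => (fun x => ‖x‖ ^ p) '' S n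
  have hVb : ∀ n, BddBelow (V n) := fun n => ⟨0, by rintro _ ⟨x, -, rfl⟩; positivity⟩
  have hVlow : ∀ n, sInf (V n) ≤ ‖xd‖ ^ p - ε := fun n => by
    obtain ⟨x, hx, hx'⟩ := hcon (1 / ((n : ℝ) + 1)) (by positivity)
    exact (csInf_le (hVb n) ⟨x, hx, rfl⟩).trans (by linarith)
  have hVne : ∀ n, (V n).Nonempty := fun n => by
    obtain ⟨x, hx, -⟩ := hcon (1 / ((n : ℝ) + 1)) (by positivity)
    exact ⟨_, x, hx, rfl⟩
  have hmono : Monotone fun n => sInf (V n) := fun m n hmn =>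
    csInf_le_csInf (hVb m) (hVne n) (Set.image_mono (hS hmn))
  obtain ⟨d, hd⟩ : ∃ d, Tendsto (fun n => sInf (V n)) atTop (𝓝 d) :=
    ⟨_, tendsto_atTop_ciSup hmono ⟨_, by rintro _ ⟨n, rfl⟩; exact hVlow n⟩⟩
  have hle : ∀ n, sInf (V n) ≤ d := fun n => hmono.ge_of_tendsto hd n
  have hex : ∀ n : ℕ, ∃ u ∈ S n, ‖u‖ ^ p < sInf (V n) + 1 / ((n : ℝ) + 1) := fun n => by
    obtain ⟨_, ⟨u, hu, rfl⟩, hlt⟩ := exists_lt_of_csInf_lt (hVne n)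
      (lt_add_of_pos_right (sInf (V n)) (by positivity : (0 : ℝ) < 1 / ((n : ℝ) + 1)))
    exact ⟨u, hu, hlt⟩
  choose u huS hu using hex
  have hone : Tendsto (fun n : ℕ => 1 / ((n : ℝ) + 1)) atTop (𝓝 0) :=
    tendsto_one_div_add_atTop_nhds_zero_nat
  have hcauchy : CauchySeq u := by
    have hb : ∀ n m, n ≤ m →
        c * ‖u n - u m‖ ^ p ≤ (d - sInf (V n)) + 1 / ((n : ℝ) + 1) := by
      intro n m hnm
      have hmid : (1 / 2 : ℝ) • (u n + u m) ∈ S n := by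
        have h1 : A ((1 / 2 : ℝ) • (u n + u m)) - y
            = (1 / 2 : ℝ) • (A (u n) - y) + (1 / 2 : ℝ) • (A (u m) - y) := by
          rw [map_smul, map_add]
          module
        have h2 := hS hnm (huS m)
        have h3 := huS n
        change ‖_‖ ≤ _ at h2 h3 ⊢
        rw [h1]
        refine (norm_add_le _ _).trans ?_
        rw [norm_smul, norm_smul, Real.norm_of_nonneg (by norm_num)]
        linarith
      have h1 := csInf_le (hVb n) ⟨_, hmid, rfl⟩
      have h2 := hc.2 (u n) (u m)
      have h3 := hu n
      have h4 := hu m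
      have h5 := hle m
      have h6 : 1 / ((m : ℝ) + 1) ≤ 1 / ((n : ℝ) + 1) :=
        one_div_le_one_div_of_le (by positivity) (by simpa using hnm)
      simp only at h1
      have h7 := hle n
      linarith
    rw [Metric.cauchySeq_iff']
    intro η hη
    have hlim : Tendsto (fun n => (d - sInf (V n)) + 1 / ((n : ℝ) + 1)) atTop (𝓝 0) := by
      simpa using ((tendsto_const_nhds (x := d)).sub hd).add hone
    obtain ⟨n, hn⟩ :=
      (hlim.eventually_lt_const (by have := hc.1; positivity : 0 < c * η ^ p)).exists
    refine ⟨n, fun m hm => ?_⟩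
    rw [dist_comm, dist_eq_norm]
    have := (mul_lt_mul_iff_right₀ hc.1).1 ((hb n m hm).trans_lt hn)
    exact lt_of_not_ge fun hge => absurd (Real.rpow_le_rpow hη.le hge hp0.le) (not_le.2 this)
  obtain ⟨v, hv⟩ := cauchySeq_tendsto_of_complete hcauchy
  have hAv : A v = y := by
    have h1 : Tendsto (fun n => ‖A (u n) - y‖) atTop (𝓝 ‖A v - y‖) :=
      (((A.continuous.tendsto v).comp hv).sub_const y).norm
    have h2 : ‖A v - y‖ ≤ 0 := le_of_tendsto_of_tendsto' h1 hone huS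
    exact sub_eq_zero.1 (norm_le_zero_iff.1 h2)
  have hvn : ‖v‖ ^ p ≤ ‖xd‖ ^ p - ε := by
    have h1 : Tendsto (fun n => ‖u n‖ ^ p) atTop (𝓝 (‖v‖ ^ p)) :=
      hv.norm.rpow_const (Or.inr hp0.le)
    have h2 : Tendsto (fun n : ℕ => ‖xd‖ ^ p - ε + 1 / ((n : ℝ) + 1)) atTop (𝓝 (‖xd‖ ^ p - ε)) := by
      simpa using tendsto_const_nhds.add hone
    exact le_of_tendsto_of_tendsto' h1 h2 fun n => by
      have := hu n
      have := hVlow n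
      linarith
  have hmin : ‖xd‖ ≤ ‖v‖ := by
    rw [h.2]
    exact csInf_le ⟨0, by rintro _ ⟨w, -, rfl⟩; exact norm_nonneg w⟩ ⟨v, hAv, rfl⟩
  have := Real.rpow_le_rpow (norm_nonneg _) hmin hp0.le
  linarith

end UniformConvexity

/-! ### Duality maps -/

section DualityMap

variable {X : Type*} [NormedAddCommGroup X] [NormedSpace ℝ X]

lemma norm_of_mem_dualityMap {t : ℝ} {z : X} {f : StrongDual ℝ X} (hf : f ∈ dualityMap t z) :
    ‖f‖ = ‖z‖ ^ (t - 1) := hf.2.symm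

lemma apply_of_mem_dualityMap {t : ℝ} (ht : 1 < t) {z : X} {f : StrongDual ℝ X}
    (hf : f ∈ dualityMap t z) : f z = ‖z‖ ^ t := by
  rw [hf.1, ← hf.2, mul_comm, ← Real.rpow_add_one' (norm_nonneg z) (by linarith), sub_add_cancel]

lemma norm_rpow_of_mem_dualityMap {p q : ℝ} (hpq : p.HolderConjugate q) {z : X}
    {f : StrongDual ℝ X} (hf : f ∈ dualityMap p z) : ‖f‖ ^ q = ‖z‖ ^ p := by
  rw [norm_of_mem_dualityMap hf, ← Real.rpow_mul (norm_nonneg z), hpq.sub_one_mul_conj]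

lemma dualityMap_nonempty {t : ℝ} (ht : 1 < t) (z : X) : (dualityMap t z).Nonempty := by
  rcases eq_or_ne z 0 with rfl | hz
  · exact ⟨0, by simp [dualityMap, Real.zero_rpow (by linarith : t - 1 ≠ 0)]⟩
  · obtain ⟨g, hg1, hg⟩ := exists_dual_vector ℝ z (norm_ne_zero_iff.2 hz)
    have hnorm : ‖‖z‖ ^ (t - 1) • g‖ = ‖z‖ ^ (t - 1) := by
      rw [norm_smul, hg1, mul_one, Real.norm_of_nonneg (by positivity)]
    refine ⟨‖z‖ ^ (t - 1) • g, ?_, hnorm.symm⟩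
    rw [hnorm]
    simp [hg, mul_comm]

lemma J_mem_dualityMap {t : ℝ} (ht : 1 < t) (z : X) : J t z ∈ dualityMap t z :=
  Classical.epsilon_spec (dualityMap_nonempty ht z)

/-- Young's inequality for the duality map: `J_t z` is a subgradient of `‖·‖ ^ t / t` at `z`. -/
lemma apply_le_of_mem_dualityMap {t : ℝ} (ht : 1 < t) {z : X} {f : StrongDual ℝ X}
    (hf : f ∈ dualityMap t z) (w : X) : f w ≤ (1 - 1 / t) * ‖z‖ ^ t + 1 / t * ‖w‖ ^ t := by
  have hc := Real.HolderConjugate.conjExponent ht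
  have h1 : f w ≤ ‖f‖ * ‖w‖ := (le_abs_self _).trans (f.le_opNorm w)
  have h2 := Real.young_inequality_of_nonneg (norm_nonneg w) (norm_nonneg f) hc
  rw [norm_rpow_of_mem_dualityMap hc hf] at h2
  have h3 : (1 - 1 / t) = 1 / t.conjExponent := by
    rw [one_div, one_div, hc.one_sub_inv]
  rw [h3]
  calc f w ≤ ‖w‖ * ‖f‖ := by linarith
    _ ≤ _ := h2
    _ = _ := by ring

lemma subgradient_of_mem_dualityMap {t : ℝ} (ht : 1 < t) {z : X} {f : StrongDual ℝ X}
    (hf : f ∈ dualityMap t z) (w : X) : ‖z‖ ^ t / t + f (w - z) ≤ ‖w‖ ^ t / t := by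
  have h1 := apply_le_of_mem_dualityMap ht hf w
  rw [map_sub, apply_of_mem_dualityMap ht hf]
  have h2 : (1 - 1 / t) * ‖z‖ ^ t = ‖z‖ ^ t - ‖z‖ ^ t / t := by ring
  have h3 : 1 / t * ‖w‖ ^ t = ‖w‖ ^ t / t := by ring
  linarith

lemma bregman_eq {t : ℝ} (ht : 1 < t) (z w : X) :
    bregman t z w = ‖w‖ ^ t / t - ‖z‖ ^ t / t - J t z (w - z) := by
  rw [bregman, map_sub, apply_of_mem_dualityMap ht (J_mem_dualityMap ht z)]
  ring

lemma bregman_nonneg {t : ℝ} (ht : 1 < t) (z w : X) : 0 ≤ bregman t z w := by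
  have := subgradient_of_mem_dualityMap ht (J_mem_dualityMap ht z) w
  rw [bregman_eq ht]
  linarith

/-- In a smooth space the duality map is single valued. -/
lemma IsSmooth.J_eq (hX : IsSmooth X) {t : ℝ} (ht : 1 < t) {z : X} {f : StrongDual ℝ X}
    (hf : f ∈ dualityMap t z) : J t z = f := by
  have hJ := J_mem_dualityMap ht z
  rcases eq_or_ne z 0 with rfl | hz
  · have h0 : ∀ g ∈ dualityMap t (0 : X), g = 0 := fun g hg => by
      have := norm_of_mem_dualityMap hg
      rwa [norm_zero, Real.zero_rpow (by linarith), norm_eq_zero] at this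
    rw [h0 _ hJ, h0 _ hf]
  · have hr : 0 < ‖z‖ ^ (t - 1) := Real.rpow_pos_of_pos (norm_pos_iff.2 hz) _
    have normalize : ∀ g ∈ dualityMap t z,
        ((‖z‖ ^ (t - 1))⁻¹ • g) z = ‖z‖ ∧ ‖(‖z‖ ^ (t - 1))⁻¹ • g‖ = 1 := fun g hg => by
      constructor
      · rw [smul_apply, hg.1, ← hg.2, smul_eq_mul]
        field_simp
      · rw [norm_smul, ← hg.2, norm_inv, Real.norm_of_nonneg hr.le, inv_mul_cancel₀ hr.ne']
    have := (hX z hz).unique (normalize _ hJ) (normalize _ hf)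
    exact smul_right_injective _ (inv_ne_zero hr.ne') this

lemma inclusion_mem_dualityMap_iff {p q : ℝ} (hpq : p.HolderConjugate q) {x : X}
    {f : StrongDual ℝ X} :
    NormedSpace.inclusionInDoubleDual ℝ X x ∈ dualityMap q f ↔ f ∈ dualityMap p x := by
  have hn : ‖NormedSpace.inclusionInDoubleDual ℝ X x‖ = ‖x‖ :=
    (NormedSpace.inclusionInDoubleDualLi ℝ).norm_map x
  have hmul : (p - 1) * (q - 1) = 1 := by
    have := hpq.mul_eq_add
    linarith
  have hinv : ∀ {a b u v : ℝ}, 0 ≤ a → u * v = 1 → a ^ u = b → b ^ v = a :=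
    fun {a b u v} ha huv h => by rw [← h, ← Real.rpow_mul ha, huv, Real.rpow_one]
  simp only [dualityMap, Set.mem_ofPred_eq, hn, NormedSpace.dual_def, mul_comm ‖f‖ ‖x‖]
  refine and_congr_right fun _ => ⟨fun h => ?_, fun h => ?_⟩
  · exact hinv (norm_nonneg f) (by rw [mul_comm, hmul]) h
  · exact hinv (norm_nonneg x) hmul h

end DualityMap

/-! ### Convexity of `X` and smoothness of its dual -/

section DualSmoothness

variable {X : Type*} [NormedAddCommGroup X] [NormedSpace ℝ X]

/-- Uniform convexity of `‖·‖ ^ p` bounds the Bregman distance from below by the distance. -/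
lemma IsMidpointConvexityConst.norm_sub_rpow_le_bregman {p c : ℝ} (hp : 1 < p)
    (hc : IsMidpointConvexityConst X p c) (z w : X) :
    2 * c / p * ‖z - w‖ ^ p ≤ bregman p z w := by
  have h1 := hc.2 z w
  have h2 := subgradient_of_mem_dualityMap hp (J_mem_dualityMap hp z) ((1 / 2 : ℝ) • (z + w))
  have h3 : (1 / 2 : ℝ) • (z + w) - z = (1 / 2 : ℝ) • (w - z) := by module
  rw [h3, map_smul, smul_eq_mul] at h2
  rw [bregman_eq hp]
  have hp0 : 0 < p := by linarith
  have h4 := div_le_div_of_nonneg_right h1 hp0.le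
  have h5 : ((‖z‖ ^ p + ‖w‖ ^ p) / 2 - c * ‖z - w‖ ^ p) / p
      = (‖z‖ ^ p / p + ‖w‖ ^ p / p) / 2 - (2 * c / p * ‖z - w‖ ^ p) / 2 := by ring
  linarith

/-- `‖f‖ ^ q / q` is the supremum of `f x - ‖x‖ ^ p / p`: the conjugate of `‖·‖ ^ p / p` is
`‖·‖ ^ q / q`. -/
lemma norm_rpow_div_le_of_forall {p q : ℝ} (hpq : p.HolderConjugate q) (f : StrongDual ℝ X) {B : ℝ}
    (h : ∀ x, f x - ‖x‖ ^ p / p ≤ B) : ‖f‖ ^ q / q ≤ B := by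
  have hq := hpq.symm.pos
  have hB : 0 ≤ B := by simpa [Real.zero_rpow hpq.ne_zero] using h 0
  have key : ∀ u : X, ‖u‖ = 1 → 0 ≤ f u → f u ≤ (q * B) ^ q⁻¹ := fun u hu hfu => by
    have h1 := h ((f u) ^ (q - 1) • u)
    rw [map_smul, smul_eq_mul, norm_smul, hu, mul_one, Real.norm_of_nonneg (by positivity),
      ← Real.rpow_mul hfu, hpq.symm.sub_one_mul_conj,
      ← Real.rpow_add_one' hfu (by simpa using hq.ne'), sub_add_cancel] at h1
    have h2 : (f u) ^ q - (f u) ^ q / p = (f u) ^ q / q := by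
      have := hpq.one_sub_inv
      calc (f u) ^ q - (f u) ^ q / p = (f u) ^ q * (1 - p⁻¹) := by ring
        _ = _ := by rw [this]; ring
    rw [h2, div_le_iff₀ hq] at h1
    rw [Real.le_rpow_inv_iff_of_pos hfu (by positivity) hq]
    linarith
  have h1 : ‖f‖ ≤ (q * B) ^ q⁻¹ :=
    ContinuousLinearMap.opNorm_le_of_unit_norm (by positivity) fun u hu => by
      rw [Real.norm_eq_abs]
      rcases le_total 0 (f u) with h0 | h0
      · rw [abs_of_nonneg h0]
        exact key u hu h0
      · rw [abs_of_nonpos h0, ← map_neg]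
        exact key (-u) (by rwa [norm_neg]) (by rw [map_neg]; linarith)
  rw [Real.le_rpow_inv_iff_of_pos (norm_nonneg _) (by positivity) hq] at h1
  rw [div_le_iff₀ hq]
  linarith

/-- The dual of a space with uniformly convex `‖·‖ ^ p` has a smoothness constant: conjugation turns
the midpoint convexity inequality into the estimate
`‖z + h‖ ^ q + ‖z - h‖ ^ q ≤ 2 ‖z‖ ^ q + C ‖h‖ ^ q` on the dual. -/
theorem IsMidpointConvexityConst.exists_dualSmoothnessConst {p q c : ℝ}
    (hpq : p.HolderConjugate q) (hc : IsMidpointConvexityConst X p c) :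
    ∃ G, IsDualSmoothnessConst X q G := by
  have hp := hpq.pos
  have hq := hpq.symm.pos
  -- `lam` is chosen so that Young's inequality absorbs `⟨h, x - y⟩` into `2 c / p * ‖x - y‖ ^ p`.
  set lam : ℝ := (2 * c) ^ p⁻¹ with hlam
  have hlam0 : 0 < lam := by have := hc.1; positivity
  have hlamp : lam ^ p = 2 * c :=
    Real.rpow_inv_rpow (by have := hc.1; positivity) hp.ne'
  have hyoung : ∀ (h : StrongDual ℝ X) (u : X),
      h u ≤ 2 * c / p * ‖u‖ ^ p + (lam⁻¹) ^ q / q * ‖h‖ ^ q := fun h u => by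
    have h1 := Real.young_inequality_of_nonneg (a := lam * ‖u‖) (b := lam⁻¹ * ‖h‖)
      (by positivity) (by positivity) hpq
    rw [Real.mul_rpow hlam0.le (norm_nonneg _),
      Real.mul_rpow (by positivity) (norm_nonneg _), hlamp] at h1
    calc h u ≤ ‖h‖ * ‖u‖ := (le_abs_self _).trans (h.le_opNorm u)
      _ = lam * ‖u‖ * (lam⁻¹ * ‖h‖) := by field_simp
      _ ≤ _ := h1
      _ = _ := by ring
  have hsum : ∀ z h : StrongDual ℝ X,
      ‖z + h‖ ^ q / q + ‖z - h‖ ^ q / q ≤ 2 * (‖z‖ ^ q / q) + (lam⁻¹) ^ q / q * ‖h‖ ^ q := by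
    intro z h
    have hxy : ∀ x y : X, ((z + h) x - ‖x‖ ^ p / p) + ((z - h) y - ‖y‖ ^ p / p)
        ≤ 2 * (‖z‖ ^ q / q) + (lam⁻¹) ^ q / q * ‖h‖ ^ q := by
      intro x y
      set m := (1 / 2 : ℝ) • (x + y) with hm
      have h1 : z m ≤ ‖m‖ ^ p / p + ‖z‖ ^ q / q :=
        ((le_abs_self _).trans (z.le_opNorm m)).trans
          (by
            rw [mul_comm]
            exact Real.young_inequality_of_nonneg (norm_nonneg _) (norm_nonneg _) hpq)
      have h2 := div_le_div_of_nonneg_right (hc.2 x y) hp.le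
      have h3 : ((‖x‖ ^ p + ‖y‖ ^ p) / 2 - c * ‖x - y‖ ^ p) / p
        = (‖x‖ ^ p / p + ‖y‖ ^ p / p) / 2 - (2 * c / p * ‖x - y‖ ^ p) / 2 := by ring
      have h4 := hyoung h (x - y)
      rw [map_sub] at h4
      have h5 : z m = (z x + z y) / 2 := by
        rw [hm, map_smul, map_add, smul_eq_mul]
        ring
      rw [add_apply, sub_apply]
      rw [← hm] at h2
      linarith
    have h1 : ∀ y : X, (z - h) y - ‖y‖ ^ p / p
        ≤ 2 * (‖z‖ ^ q / q) + (lam⁻¹) ^ q / q * ‖h‖ ^ q - ‖z + h‖ ^ q / q := fun y => by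
      have := norm_rpow_div_le_of_forall hpq (z + h)
        (B := 2 * (‖z‖ ^ q / q) + (lam⁻¹) ^ q / q * ‖h‖ ^ q - ((z - h) y - ‖y‖ ^ p / p))
        fun x => by linarith [hxy x y]
      linarith
    have := norm_rpow_div_le_of_forall hpq (z - h) h1
    linarith
  refine ⟨(lam⁻¹) ^ q, by positivity, fun z w => ?_⟩
  have hq1 : 1 < q := hpq.symm.lt
  have h1 := subgradient_of_mem_dualityMap hq1 (J_mem_dualityMap hq1 z) (z - (w - z))
  have h2 := hsum z (w - z)
  rw [add_sub_cancel] at h2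
  rw [sub_sub_cancel_left, map_neg] at h1
  rw [bregman_eq hq1]
  linarith

lemma eq_zero_of_apply_le_rpow {E : Type*} [NormedAddCommGroup E] [NormedSpace ℝ E]
    {q C : ℝ} (hq : 1 < q) (g : StrongDual ℝ E) (h : ∀ u, g u ≤ C * ‖u‖ ^ q) : g = 0 := by
  have key : ∀ u, g u ≤ 0 := fun u => by
    have h1 : ∀ t : ℝ, 0 < t → g u ≤ C * ‖u‖ ^ q * t ^ (q - 1) := fun t ht => by
      have h2 := h (t • u)
      rw [map_smul, smul_eq_mul, norm_smul, Real.norm_of_nonneg ht.le,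
        Real.mul_rpow ht.le (norm_nonneg _)] at h2
      have h3 : t ^ q = t ^ (q - 1) * t := by
        rw [← Real.rpow_add_one ht.ne', sub_add_cancel]
      rw [h3] at h2
      refine le_of_mul_le_mul_left (h2.trans (le_of_eq ?_)) ht
      ring
    have h2 : Tendsto (fun t : ℝ => C * ‖u‖ ^ q * t ^ (q - 1)) (𝓝[>] 0) (𝓝 0) := by
      have : Tendsto (fun t : ℝ => t ^ (q - 1)) (𝓝 0) (𝓝 (0 ^ (q - 1))) :=
        (Real.continuousAt_rpow_const 0 (q - 1) (Or.inr (by linarith))).tendsto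
      rw [Real.zero_rpow (by linarith)] at this
      simpa using (this.const_mul (C * ‖u‖ ^ q)).mono_left nhdsWithin_le_nhds
    exact ge_of_tendsto h2 (by filter_upwards [self_mem_nhdsWithin] with t ht using h1 t ht)
  ext u
  have h1 := key u
  have h2 := key (-u)
  rw [map_neg] at h2
  rw [zero_apply]
  linarith

/-- If the dual of `X` has a smoothness constant, its duality map is single valued. -/
lemma IsDualSmoothnessConst.J_eq {q G : ℝ} (hq : 1 < q) (hG : IsDualSmoothnessConst X q G)
    {z : StrongDual ℝ X} {b : StrongDual ℝ (StrongDual ℝ X)} (hb : b ∈ dualityMap q z) :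
    J q z = b := by
  have h : b - J q z = 0 := eq_zero_of_apply_le_rpow hq (C := G / q) _ fun u => by
    have h1 := subgradient_of_mem_dualityMap hq hb (z + u)
    have h2 := hG.2 z (z + u)
    rw [bregman_eq hq] at h2
    rw [add_sub_cancel_left] at h1 h2
    rw [sub_apply]
    linarith
  exact (sub_eq_zero.1 h).symm

/-- Descent inequality on the dual: if `z ∈ J_p x`, then `x` is the gradient of `‖·‖ ^ q / q`
at `z`. -/
lemma IsDualSmoothnessConst.norm_add_rpow_le {p q G : ℝ} (hpq : p.HolderConjugate q)
    (hG : IsDualSmoothnessConst X q G) {x : X} {z : StrongDual ℝ X} (hz : z ∈ dualityMap p x)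
    (h : StrongDual ℝ X) : ‖z + h‖ ^ q / q ≤ ‖z‖ ^ q / q + h x + G / q * ‖h‖ ^ q := by
  have hq := hpq.symm.lt
  have h1 := hG.2 z (z + h)
  rw [bregman_eq hq, hG.J_eq hq ((inclusion_mem_dualityMap_iff hpq).2 hz), add_sub_cancel_left,
    NormedSpace.dual_def] at h1
  linarith

end DualSmoothness

/-! ### Continuity of the duality map of a uniformly smooth space -/

section UniformSmoothness

variable {X : Type*} [NormedAddCommGroup X] [NormedSpace ℝ X]

lemma norm_add_norm_sub_le_modulusSmoothness {τ : ℝ} (hτ : 0 ≤ τ) {z w : X} (hz : ‖z‖ = 1)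
    (hw : ‖w‖ = 1) : ‖z + τ • w‖ + ‖z - τ • w‖ ≤ 2 + 2 * modulusSmoothness X τ := by
  have hb : BddAbove {s : ℝ | ∃ z w : X, ‖z‖ = 1 ∧ ‖w‖ = 1 ∧
      s = (‖z + τ • w‖ + ‖z - τ • w‖) / 2 - 1} := by
    refine ⟨τ, ?_⟩
    rintro _ ⟨z, w, hz, hw, rfl⟩
    have h1 := norm_add_le z (τ • w)
    have h2 := norm_sub_le z (τ • w)
    rw [norm_smul, hz, hw, Real.norm_of_nonneg hτ] at h1 h2
    linarith
  have h1 : (‖z + τ • w‖ + ‖z - τ • w‖) / 2 - 1 ≤ modulusSmoothness X τ :=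
    le_csSup hb ⟨z, w, hz, hw, rfl⟩
  linarith

/-- Norming functionals of two unit vectors are close when the vectors are, by a bound in terms of
the modulus of smoothness. -/
lemma norm_sub_le_modulusSmoothness {τ : ℝ} (hτ : 0 < τ) {u v : X} (hu : ‖u‖ = 1)
    {f g : StrongDual ℝ X} (hf : ‖f‖ = 1) (hg : ‖g‖ = 1) (hfu : f u = 1) (hgv : g v = 1) :
    ‖g - f‖ ≤ 2 * (modulusSmoothness X τ / τ) + ‖u - v‖ / τ := by
  have key : ∀ w : X, ‖w‖ = 1 → (g - f) w ≤ 2 * (modulusSmoothness X τ / τ) + ‖u - v‖ / τ := by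
    intro w hw
    have bound : ∀ (k : StrongDual ℝ X) (a : X), ‖k‖ = 1 → |k a| ≤ ‖a‖ := fun k a hk => by
      have := k.le_opNorm a
      rwa [hk, one_mul] at this
    have h1 := (abs_le.1 (bound g (u + τ • w) hg)).2
    have h2 := (abs_le.1 (bound f (u - τ • w) hf)).2
    have h3 := (abs_le.1 (bound g (u - v) hg)).1
    have h4 := norm_add_norm_sub_le_modulusSmoothness hτ.le hu hw
    rw [map_add, map_smul, smul_eq_mul] at h1
    rw [map_sub, map_smul, smul_eq_mul, hfu] at h2
    rw [map_sub, hgv] at h3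
    have h5 : (g w - f w) * τ ≤ 2 * modulusSmoothness X τ + ‖u - v‖ := by linarith
    have h6 : 2 * (modulusSmoothness X τ / τ) + ‖u - v‖ / τ
        = (2 * modulusSmoothness X τ + ‖u - v‖) / τ := by ring
    rw [h6, sub_apply, le_div_iff₀ hτ]
    exact h5
  have hex : 0 ≤ 2 * (modulusSmoothness X τ / τ) + ‖u - v‖ / τ := by
    have h1 := key u hu
    have h2 := key (-u) (by rwa [norm_neg])
    rw [map_neg] at h2
    linarith
  refine ContinuousLinearMap.opNorm_le_of_unit_norm hex fun w hw => abs_le.2 ⟨?_, key w hw⟩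
  have := key (-w) (by rwa [norm_neg])
  rw [map_neg] at this
  linarith

lemma IsUniformlySmooth.continuous_J (hX : IsUniformlySmooth X) {p : ℝ} (hp : 1 < p) :
    Continuous (J p : X → StrongDual ℝ X) := by
  rw [continuous_iff_continuousAt]
  intro x
  have hpow : ∀ x : X, Tendsto (fun u : X => ‖u‖ ^ (p - 1)) (𝓝 x) (𝓝 (‖x‖ ^ (p - 1))) := fun x =>
    (continuous_norm.tendsto x).rpow_const (Or.inr (by linarith))
  rcases eq_or_ne x 0 with rfl | hx
  · have h0 : J p (0 : X) = 0 := by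
      have := norm_of_mem_dualityMap (J_mem_dualityMap hp (0 : X))
      rwa [norm_zero, Real.zero_rpow (by linarith), norm_eq_zero] at this
    rw [ContinuousAt, h0, tendsto_zero_iff_norm_tendsto_zero]
    have := hpow 0
    rw [norm_zero, Real.zero_rpow (by linarith)] at this
    exact this.congr fun u => (norm_of_mem_dualityMap (J_mem_dualityMap hp u)).symm
  · let e : X → StrongDual ℝ X := fun u => (‖u‖ ^ (p - 1))⁻¹ • J p u
    have hpos : ∀ u : X, u ≠ 0 → 0 < ‖u‖ ^ (p - 1) := fun u hu =>
      Real.rpow_pos_of_pos (norm_pos_iff.2 hu) _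
    have hJe : ∀ u : X, u ≠ 0 → J p u = ‖u‖ ^ (p - 1) • e u := fun u hu => by
      simp only [e]
      rw [smul_smul, mul_inv_cancel₀ (hpos u hu).ne', one_smul]
    have he1 : ∀ u : X, u ≠ 0 → ‖e u‖ = 1 := fun u hu => by
      simp only [e]
      rw [norm_smul, norm_of_mem_dualityMap (J_mem_dualityMap hp u), norm_inv,
        Real.norm_of_nonneg (hpos u hu).le, inv_mul_cancel₀ (hpos u hu).ne']
    have heu : ∀ u : X, u ≠ 0 → e u (‖u‖⁻¹ • u) = 1 := fun u hu => by
      have hJu := J_mem_dualityMap hp u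
      have := hpos u hu
      have := norm_pos_iff.2 hu
      simp only [e]
      rw [smul_apply, map_smul, hJu.1, ← hJu.2]
      simp only [smul_eq_mul]
      field_simp
    have hunit : ∀ u : X, u ≠ 0 → ‖‖u‖⁻¹ • u‖ = 1 := fun u hu => by
      rw [norm_smul, norm_inv, norm_norm, inv_mul_cancel₀ (norm_ne_zero_iff.2 hu)]
    have hne : ∀ᶠ u in 𝓝 x, u ≠ 0 := eventually_ne_nhds hx
    have hnorm : Tendsto (fun u : X => ‖‖x‖⁻¹ • x - ‖u‖⁻¹ • u‖) (𝓝 x) (𝓝 0) := by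
      have h1 : Tendsto (fun u : X => ‖u‖⁻¹ • u) (𝓝 x) (𝓝 (‖x‖⁻¹ • x)) :=
        ((continuous_norm.tendsto x).inv₀ (norm_ne_zero_iff.2 hx)).smul tendsto_id
      simpa using (tendsto_const_nhds.sub h1 : Tendsto
        (fun u : X => ‖x‖⁻¹ • x - ‖u‖⁻¹ • u) (𝓝 x) (𝓝 (‖x‖⁻¹ • x - ‖x‖⁻¹ • x))).norm
    have hte : Tendsto e (𝓝 x) (𝓝 (e x)) := by
      rw [Metric.tendsto_nhds]
      intro ε hε
      obtain ⟨τ, hτρ, hτ⟩ := ((hX.eventually_lt_const (by positivity : 0 < ε / 4)).and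
        self_mem_nhdsWithin).exists
      have hτ : 0 < τ := hτ
      filter_upwards [hne, hnorm.eventually_lt_const (by positivity : 0 < ε / 4 * τ)] with u hu hux
      rw [dist_eq_norm]
      have h1 := norm_sub_le_modulusSmoothness hτ (hunit x hx) (he1 x hx) (he1 u hu) (heu x hx)
        (heu u hu)
      rw [← div_lt_iff₀ hτ] at hux
      linarith
    have h1 := (hpow x).smul hte
    rw [ContinuousAt, hJe x hx]
    exact h1.congr' (by filter_upwards [hne] with u hu using (hJe u hu).symm)

end UniformSmoothness

/-! ### Elementary facts on real numbers and sequences -/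

section Real

lemma rpow_sub_one_mul_le {p a b : ℝ} (hp : 1 < p) (ha : 0 ≤ a) (hb : 0 ≤ b) :
    a ^ (p - 1) * b ≤ a ^ p + b ^ p := by
  have e : ∀ u : ℝ, 0 ≤ u → u ^ p = u ^ (p - 1) * u := fun u hu => by
    rw [← Real.rpow_add_one' hu (by linarith), sub_add_cancel]
  have ha' : 0 ≤ a ^ p := by positivity
  have hb' : 0 ≤ b ^ p := by positivity
  rcases le_total b a with h | h
  · calc a ^ (p - 1) * b ≤ a ^ (p - 1) * a := by gcongr
      _ = a ^ p := (e a ha).symm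
      _ ≤ _ := by linarith
  · calc a ^ (p - 1) * b ≤ b ^ (p - 1) * b := by
          have : 0 ≤ p - 1 := by linarith
          gcongr
      _ = b ^ p := (e b hb).symm
      _ ≤ _ := by linarith

lemma exists_rpow_le_add_mul_rpow {r p : ℝ} (hr : 0 < r) (hrp : r ≤ p) {η : ℝ} (hη : 0 < η) :
    ∃ C, 0 ≤ C ∧ ∀ t : ℝ, 0 ≤ t → t ^ r ≤ η + C * t ^ p := by
  refine ⟨(η ^ r⁻¹) ^ (r - p), by positivity, fun t ht => ?_⟩
  rcases le_or_gt t (η ^ r⁻¹) with h | h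
  · have h1 := Real.rpow_le_rpow ht h hr.le
    rw [Real.rpow_inv_rpow hη.le hr.ne'] at h1
    have h2 : 0 ≤ (η ^ r⁻¹) ^ (r - p) * t ^ p := by positivity
    linarith
  · have h0 : 0 < η ^ r⁻¹ := by positivity
    have h1 : t ^ r = t ^ (r - p) * t ^ p := by
      rw [← Real.rpow_add (h0.trans h), sub_add_cancel]
    have h2 : t ^ (r - p) ≤ (η ^ r⁻¹) ^ (r - p) :=
      Real.rpow_le_rpow_of_nonpos h0 h.le (by linarith)
    rw [h1]
    have := mul_le_mul_of_nonneg_right h2 (Real.rpow_nonneg ht p)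
    linarith

lemma summable_of_eventually_le_mul_sub {b d : ℕ → ℝ} {C : ℝ} (hC : 0 ≤ C) (hb : ∀ k, 0 ≤ b k)
    (hd : ∀ k, 0 ≤ d k) (h : ∀ᶠ k in atTop, b k ≤ C * (d k - d (k + 1))) : Summable b := by
  obtain ⟨k, hk⟩ := eventually_atTop.1 h
  rw [← summable_nat_add_iff k]
  refine summable_of_sum_range_le (c := C * d k) (fun n => hb _) fun n => ?_
  have h1 : ∑ i ∈ Finset.range n, b (i + k)
      ≤ ∑ i ∈ Finset.range n, C * (d (i + k) - d (i + 1 + k)) :=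
    Finset.sum_le_sum fun i _ => by
      have := hk (i + k) (by omega)
      rwa [show i + k + 1 = i + 1 + k by omega] at this
  rw [← Finset.mul_sum, Finset.sum_range_sub' (fun i => d (i + k))] at h1
  refine h1.trans (mul_le_mul_of_nonneg_left ?_ hC)
  have := hd (n + k)
  simp only [zero_add]
  linarith

lemma exists_sum_Ico_le {b : ℕ → ℝ} (h : Summable b) {ε : ℝ} (hε : 0 < ε) :
    ∃ m, ∀ n, m ≤ n → ∑ l ∈ Finset.Ico m n, b l ≤ ε := by
  obtain ⟨m, hm⟩ := Metric.cauchySeq_iff'.1 h.hasSum.tendsto_sum_nat.cauchySeq ε hε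
  refine ⟨m, fun n hn => ?_⟩
  rw [Finset.sum_Ico_eq_sub _ hn]
  have := hm n hn
  rw [Real.dist_eq] at this
  exact (le_abs_self _).trans this.le

/-- If `∑ μ k = ∞` and `∑ μ k * a k < ∞`, there are arbitrarily late indices at which `a` is small
and is a running minimum. -/
lemma exists_le_and_forall_le {μ a : ℕ → ℝ} (hμ : ∀ k, 0 ≤ μ k) (hdiv : ¬ Summable μ)
    (hsum : Summable fun k => μ k * a k) (m : ℕ) {ε : ℝ} (hε : 0 < ε) :
    ∃ n, m ≤ n ∧ a n ≤ ε ∧ ∀ l ∈ Finset.Ico m n, a n ≤ a l := by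
  have hex : ∃ n, m ≤ n ∧ a n ≤ ε := by
    by_contra! hcon
    refine hdiv ((summable_nat_add_iff m).1 ?_)
    refine Summable.of_nonneg_of_le (fun k => hμ _) (fun k => ?_)
      (((summable_nat_add_iff m).2 hsum).mul_left ε⁻¹)
    have h1 := mul_le_mul_of_nonneg_left (hcon (k + m) (by omega)).le (hμ (k + m))
    rw [inv_mul_eq_div, le_div_iff₀ hε]
    exact h1
  classical
  refine ⟨Nat.find hex, (Nat.find_spec hex).1, (Nat.find_spec hex).2, fun l hl => ?_⟩
  rw [Finset.mem_Ico] at hl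
  have h1 := Nat.find_min hex hl.2
  have h2 := (Nat.find_spec hex).2
  have h3 : ε < a l := by
    by_contra! h4
    exact h1 ⟨hl.1, h4⟩
  linarith

lemma tendsto_zero_of_antitone {d : ℕ → ℝ} (hd : Antitone d) (h0 : ∀ k, 0 ≤ d k)
    (h : ∀ ε > 0, ∃ n, d n ≤ ε) : Tendsto d atTop (𝓝 0) := by
  rw [Metric.tendsto_atTop]
  intro ε hε
  obtain ⟨n, hn⟩ := h (ε / 2) (by positivity)
  refine ⟨n, fun k hk => ?_⟩
  rw [Real.dist_eq, sub_zero, abs_of_nonneg (h0 k)]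
  have := hd hk
  linarith

end Real

/-! ### Residuals and update directions -/

section Residual

variable {X : Type*} [NormedAddCommGroup X] [NormedSpace ℝ X]
  {N : ℕ} {Y : Fin N → Type*} [∀ i, NormedAddCommGroup (Y i)] [∀ i, NormedSpace ℝ (Y i)]
  {s : ENNReal}

/-- The sum `∑ i, ‖A_i x - y_i‖ ^ p` of the powers of the residuals. -/
noncomputable def residualSum (p : ℝ) (A : X →L[ℝ] PiLp s Y) (y : PiLp s Y) (x : X) : ℝ :=
  ∑ i, ‖component A i x - y i‖ ^ p

variable {A : X →L[ℝ] PiLp s Y} {y : PiLp s Y} {j : ∀ i, Y i → StrongDual ℝ (Y i)} {p q : ℝ}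

lemma residualSum_nonneg (x : X) : 0 ≤ residualSum p A y x :=
  Finset.sum_nonneg fun _ _ => by positivity

lemma rpow_residual_le_residualSum (x : X) (i : Fin N) :
    ‖component A i x - y i‖ ^ p ≤ residualSum p A y x :=
  Finset.single_le_sum (f := fun i => ‖component A i x - y i‖ ^ p) (fun _ _ => by positivity)
    (Finset.mem_univ i)

lemma norm_component_apply_le [Fact (1 ≤ s)] (x : X) (i : Fin N) : ‖component A i x‖ ≤ ‖A x‖ :=
  PiLp.norm_apply_le (A x) i

lemma norm_component_le_Lmax (i : Fin N) : ‖component A i‖ ≤ Lmax A :=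
  le_ciSup (f := fun i => ‖component A i‖) (Set.finite_range _).bddAbove i

lemma component_sub_of_solution {xd : X} (hA : A xd = y) (x : X) (i : Fin N) :
    component A i (x - xd) = component A i x - y i := by
  rw [map_sub]
  congr 1
  rw [← hA]
  rfl

variable (A y) in
/-- The norm of `PiLp s Y` enters only through its equivalence with the supremum norm, so the
exponent `s` is unrelated to `p`. -/
lemma exists_mul_norm_residual_le [Fact (1 ≤ s)] (hp : 1 ≤ p) {C : ℝ} (hC : 0 ≤ C) {ε : ℝ}
    (hε : 0 < ε) : ∃ C', 0 ≤ C' ∧ ∀ x, C * ‖A x - y‖ ≤ ε + C' * residualSum p A y x := by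
  set K : NNReal := (Fintype.card (Fin N) : NNReal) ^ (1 / s).toReal with hK
  obtain ⟨C₂, hC₂, h₂⟩ := exists_rpow_le_add_mul_rpow one_pos hp
    (by positivity : 0 < ε / (C * K + 1))
  refine ⟨C * K * C₂, by positivity, fun x => ?_⟩
  have h1 : ‖A x - y‖ ≤ K * ‖WithLp.ofLp (A x - y)‖ := by
    have := (PiLp.antilipschitzWith_ofLp s Y).le_mul_dist (A x - y) 0
    rwa [dist_zero_right, WithLp.ofLp_zero, dist_zero_right] at this
  have h2 : ‖WithLp.ofLp (A x - y)‖ ≤ ε / (C * K + 1) + C₂ * residualSum p A y x := by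
    have h0 := residualSum_nonneg (p := p) (A := A) (y := y) x
    rw [pi_norm_le_iff_of_nonneg (by positivity)]
    intro i
    have h3 := h₂ ‖component A i x - y i‖ (norm_nonneg _)
    rw [Real.rpow_one] at h3
    have h4 := mul_le_mul_of_nonneg_left
      (rpow_residual_le_residualSum (p := p) (A := A) (y := y) x i) hC₂
    exact h3.trans (by linarith)
  have h3 : C * K * (ε / (C * K + 1)) ≤ ε := by
    rw [mul_div_assoc', div_le_iff₀ (by positivity)]
    nlinarith
  calc C * ‖A x - y‖ ≤ C * (K * (ε / (C * K + 1) + C₂ * residualSum p A y x)) := by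
        gcongr
        exact h1.trans (by gcongr)
    _ = C * K * (ε / (C * K + 1)) + C * K * C₂ * residualSum p A y x := by ring
    _ ≤ _ := by gcongr

/-- The form of `IsMinNormSolution.norm_rpow_le_of_residual_le` that can be integrated: away from
the approximate solutions, the residual term dominates `‖xd‖ ^ p`. -/
lemma IsMinNormSolution.exists_norm_rpow_le [Fact (1 ≤ s)] [CompleteSpace X] {xd : X}
    (h : IsMinNormSolution A y xd) {c : ℝ} (hp : 2 ≤ p) (hc : IsMidpointConvexityConst X p c)
    {ε : ℝ} (hε : 0 < ε) :
    ∃ C, 0 ≤ C ∧ ∀ x, ‖xd‖ ^ p ≤ ‖x‖ ^ p + ε + C * residualSum p A y x := by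
  obtain ⟨δ, hδ, h1⟩ := h.norm_rpow_le_of_residual_le hp hc (half_pos hε)
  obtain ⟨C, hC, h2⟩ := exists_mul_norm_residual_le A y (by linarith : 1 ≤ p)
    (by positivity : 0 ≤ ‖xd‖ ^ p / δ) (half_pos hε)
  refine ⟨C, hC, fun x => ?_⟩
  have hS := mul_nonneg hC (residualSum_nonneg (p := p) (A := A) (y := y) x)
  rcases le_or_gt ‖A x - y‖ δ with hx | hx
  · have := h1 x hx
    linarith
  · have h3 := h2 x
    have h4 : ‖xd‖ ^ p ≤ ‖xd‖ ^ p / δ * ‖A x - y‖ := by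
      rw [div_mul_eq_mul_div, le_div_iff₀ hδ]
      gcongr
    have h5 : 0 ≤ ‖x‖ ^ p := by positivity
    linarith

lemma abs_updateDir_apply_le (hj : ∀ i, IsDualitySelection p (j i)) (x u : X) (i : Fin N) :
    |updateDir A y j x i u| ≤ ‖component A i x - y i‖ ^ (p - 1) * ‖component A i u‖ := by
  have h := (j i (component A i x - y i)).le_opNorm (component A i u)
  rwa [norm_of_mem_dualityMap (hj i _)] at h

lemma updateDir_apply_sub_solution (hp : 1 < p) (hj : ∀ i, IsDualitySelection p (j i)) {xd : X}
    (hA : A xd = y) (x : X) (i : Fin N) :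
    updateDir A y j x i (x - xd) = ‖component A i x - y i‖ ^ p := by
  change j i (component A i x - y i) (component A i (x - xd)) = _
  rw [component_sub_of_solution hA, apply_of_mem_dualityMap hp (hj i _)]

lemma norm_updateDir_rpow_le (hpq : p.HolderConjugate q) (hj : ∀ i, IsDualitySelection p (j i))
    (x : X) (i : Fin N) :
    ‖updateDir A y j x i‖ ^ q ≤ Lmax A ^ q * ‖component A i x - y i‖ ^ p := by
  have h1 : ‖updateDir A y j x i‖ ≤ Lmax A * ‖j i (component A i x - y i)‖ := by
    refine (ContinuousLinearMap.opNorm_comp_le _ _).trans ?_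
    rw [mul_comm]
    gcongr
    exact norm_component_le_Lmax i
  have hL : 0 ≤ Lmax A := (norm_nonneg _).trans (norm_component_le_Lmax i)
  refine (Real.rpow_le_rpow (norm_nonneg _) h1 hpq.symm.nonneg).trans (le_of_eq ?_)
  rw [Real.mul_rpow hL (norm_nonneg _), norm_rpow_of_mem_dualityMap hpq (hj i _)]

end Residual

/-! ### Pathwise properties of the iteration -/

section Pathwise

variable {X : Type*} [NormedAddCommGroup X] [NormedSpace ℝ X]
  {N : ℕ} {Y : Fin N → Type*} [∀ i, NormedAddCommGroup (Y i)] [∀ i, NormedSpace ℝ (Y i)]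
  {s : ENNReal} {Ω : Type*} {p q : ℝ} {A : X →L[ℝ] PiLp s Y} {y : PiLp s Y}
  {j : ∀ i, Y i → StrongDual ℝ (Y i)} {μ : ℕ → ℝ} {idx : ℕ → Ω → Fin N} {x₀ : X}
  {x : ℕ → Ω → X} {G : ℝ}

lemma IsSGD.mem_dualityMap (hx : IsSGD p q A y j μ idx x₀ x) (hpq : p.HolderConjugate q) (k : ℕ)
    (ω : Ω) : J p (x k ω) - μ k • updateDir A y j (x k ω) (idx k ω) ∈ dualityMap p (x (k + 1) ω) :=
  (inclusion_mem_dualityMap_iff hpq).1 (hx.step k ω)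

lemma IsSGD.J_succ (hx : IsSGD p q A y j μ idx x₀ x) (hpq : p.HolderConjugate q)
    (hsmooth : IsSmooth X) (k : ℕ) (ω : Ω) :
    J p (x (k + 1) ω) = J p (x k ω) - μ k • updateDir A y j (x k ω) (idx k ω) :=
  hsmooth.J_eq hpq.lt (hx.mem_dualityMap hpq k ω)

/-- The iterate `x n` is determined by the first `n` indices. -/
lemma IsSGD.eq_of_idx_eq (hx : IsSGD p q A y j μ idx x₀ x) (hpq : p.HolderConjugate q)
    (hG : IsDualSmoothnessConst X q G) {ω ω' : Ω} :
    ∀ n, (∀ k < n, idx k ω = idx k ω') → x n ω = x n ω' := by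
  intro n
  induction n with
  | zero => intro _; rw [hx.init, hx.init]
  | succ n ih =>
    intro h
    have hn := ih fun k hk => h k (by omega)
    have h1 := hG.J_eq hpq.symm.lt (hx.step n ω)
    have h2 := hG.J_eq hpq.symm.lt (hx.step n ω')
    rw [hn, h n (by omega)] at h1
    exact (NormedSpace.inclusionInDoubleDualLi ℝ).injective (h1.symm.trans h2)

/-- Each step decreases the Bregman distance to a solution. -/
lemma IsSGD.bregman_succ_le (hx : IsSGD p q A y j μ idx x₀ x) (hpq : p.HolderConjugate q)
    (hsmooth : IsSmooth X) (hG : IsDualSmoothnessConst X q G)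
    (hj : ∀ i, IsDualitySelection p (j i)) (hμ : ∀ k, 0 < μ k) {xd : X} (hA : A xd = y)
    (k : ℕ) (ω : Ω) :
    bregman p (x (k + 1) ω) xd ≤ bregman p (x k ω) xd
      - μ k * (1 - G * Lmax A ^ q * μ k ^ (q - 1) / q)
        * ‖component A (idx k ω) (x k ω) - y (idx k ω)‖ ^ p := by
  have hp := hpq.lt
  have hq := hpq.symm.pos
  set g := updateDir A y j (x k ω) (idx k ω) with hg
  set R := ‖component A (idx k ω) (x k ω) - y (idx k ω)‖ ^ p with hR
  have hJ := hx.J_succ hpq hsmooth k ω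
  have dual : ∀ u : X, (1 - 1 / p) * ‖u‖ ^ p = ‖J p u‖ ^ q / q := fun u => by
    rw [norm_rpow_of_mem_dualityMap hpq (J_mem_dualityMap hp u), one_div, hpq.one_sub_inv]
    ring
  have h1 := hG.norm_add_rpow_le hpq (J_mem_dualityMap hp (x k ω)) (-(μ k • g))
  rw [← sub_eq_add_neg, ← hJ, norm_neg, norm_smul, Real.norm_of_nonneg (hμ k).le,
    Real.mul_rpow (hμ k).le (norm_nonneg _), neg_apply, smul_apply, smul_eq_mul] at h1
  have h2 : ‖g‖ ^ q ≤ Lmax A ^ q * R := norm_updateDir_rpow_le hpq hj _ _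
  have h3 : g (x k ω) - g xd = R := by
    rw [← map_sub]
    exact updateDir_apply_sub_solution hp hj hA _ _
  have h4 : μ k ^ q = μ k * μ k ^ (q - 1) := by
    rw [mul_comm, ← Real.rpow_add_one (hμ k).ne', sub_add_cancel]
  have h5 : G / q * (μ k ^ q * ‖g‖ ^ q) ≤ G / q * (μ k ^ q * (Lmax A ^ q * R)) := by
    have := hG.1
    have := (hμ k).le
    gcongr
  have h6 : J p (x (k + 1) ω) xd = J p (x k ω) xd - μ k * g xd := by
    rw [hJ, sub_apply, smul_apply, smul_eq_mul]
  rw [bregman, bregman, dual, dual, h6]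
  have h7 : G / q * (μ k ^ q * (Lmax A ^ q * R))
      = μ k * (G * Lmax A ^ q * μ k ^ (q - 1) / q) * R := by
    rw [h4]
    ring
  have h8 : μ k * g (x k ω) - μ k * g xd = μ k * R := by rw [← mul_sub, h3]
  have h9 : μ k * (1 - G * Lmax A ^ q * μ k ^ (q - 1) / q) * R
      = μ k * R - μ k * (G * Lmax A ^ q * μ k ^ (q - 1) / q) * R := by ring
  linarith

lemma IsSGD.J_sub_J_eq (hx : IsSGD p q A y j μ idx x₀ x) (hpq : p.HolderConjugate q)
    (hsmooth : IsSmooth X) {m n : ℕ} (hmn : m ≤ n) (ω : Ω) :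
    J p (x n ω) - J p (x m ω)
      = -∑ l ∈ Finset.Ico m n, μ l • updateDir A y j (x l ω) (idx l ω) := by
  induction n, hmn using Nat.le_induction with
  | base => simp
  | succ n hmn ih =>
    rw [Finset.sum_Ico_succ_top hmn, hx.J_succ hpq hsmooth, neg_add, ← ih]
    abel

lemma IsSGD.J_sub_J_apply_le (hx : IsSGD p q A y j μ idx x₀ x) (hpq : p.HolderConjugate q)
    (hsmooth : IsSmooth X) (hj : ∀ i, IsDualitySelection p (j i)) (hμ : ∀ k, 0 < μ k) {xd : X}
    (hA : A xd = y) {m n : ℕ} (hmn : m ≤ n) (ω : Ω) :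
    (J p (x n ω) - J p (x m ω)) (x n ω - xd) ≤ ∑ l ∈ Finset.Ico m n,
      μ l * (‖component A (idx l ω) (x l ω) - y (idx l ω)‖ ^ p + residualSum p A y (x n ω)) := by
  rw [hx.J_sub_J_eq hpq hsmooth hmn, neg_apply, sum_apply, ← Finset.sum_neg_distrib]
  refine Finset.sum_le_sum fun l _ => ?_
  rw [smul_apply, smul_eq_mul, ← mul_neg]
  refine mul_le_mul_of_nonneg_left ?_ (hμ l).le
  refine (neg_le_abs _).trans ((abs_updateDir_apply_le hj _ _ _).trans ?_)
  rw [component_sub_of_solution hA]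
  refine (rpow_sub_one_mul_le hpq.lt (norm_nonneg _) (norm_nonneg _)).trans ?_
  gcongr
  exact rpow_residual_le_residualSum _ _

/-- The dual iterates stay in the closure of the range of the adjoint, uniformly over the sample
space: the range contributes `C * ‖A u‖`
and the distance to it `ε * ‖u‖`. -/
lemma IsSGD.exists_abs_J_apply_le [Fact (1 ≤ s)] (hx : IsSGD p q A y j μ idx x₀ x)
    (hpq : p.HolderConjugate q) (hsmooth : IsSmooth X)
    (hj : ∀ i, IsDualitySelection p (j i)) (hμ : ∀ k, 0 < μ k)
    (hx₀ : J p x₀ ∈ closure (Set.range (adjointMap A))) {R : ℝ} (hR0 : 0 ≤ R)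
    (hR : ∀ k ω i, ‖component A i (x k ω) - y i‖ ≤ R) {ε : ℝ} (hε : 0 < ε) (m : ℕ) :
    ∃ C, 0 ≤ C ∧ ∀ ω u, |J p (x m ω) u| ≤ ε * ‖u‖ + C * ‖A u‖ := by
  induction m with
  | zero =>
    obtain ⟨_, ⟨f, rfl⟩, hf⟩ := Metric.mem_closure_iff.1 hx₀ ε hε
    refine ⟨‖f‖, norm_nonneg f, fun ω u => ?_⟩
    rw [hx.init]
    have h1 : J p x₀ u = (J p x₀ - adjointMap A f) u + f (A u) := by
      rw [sub_apply]
      exact (sub_add_cancel _ _).symm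
    rw [h1]
    refine (abs_add_le _ _).trans (add_le_add ?_ (f.le_opNorm _))
    refine ((J p x₀ - adjointMap A f).le_opNorm u).trans ?_
    rw [dist_eq_norm] at hf
    gcongr
  | succ m ih =>
    obtain ⟨C, hC, h⟩ := ih
    have hμ' := (hμ m).le
    refine ⟨C + μ m * R ^ (p - 1), by positivity, fun ω u => ?_⟩
    rw [hx.J_succ hpq hsmooth, sub_apply, smul_apply, smul_eq_mul]
    refine (abs_sub _ _).trans ?_
    rw [abs_mul, abs_of_nonneg hμ']
    have h1 : |updateDir A y j (x m ω) (idx m ω) u| ≤ R ^ (p - 1) * ‖A u‖ := by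
      refine (abs_updateDir_apply_le hj _ _ _).trans ?_
      have := hpq.sub_one_pos.le
      gcongr
      · exact hR m ω _
      · exact norm_component_apply_le u _
    have h2 := mul_le_mul_of_nonneg_left h1 hμ'
    have h3 := h ω u
    linarith

end Pathwise

/-! ### Expectations over the random indices -/

section Sampling

lemma exists_factor_of_idx_eq {N : ℕ} {Ω E : Type*} [Nonempty E] {idx : ℕ → Ω → Fin N}
    {x : ℕ → Ω → E} {n : ℕ} (hx : ∀ ω ω', (∀ k < n, idx k ω = idx k ω') → x n ω = x n ω') :
    ∃ F : (Finset.range n → Fin N) → E, ∀ ω, x n ω = F fun k => idx k ω := by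
  have : (x n).FactorsThrough fun ω (k : Finset.range n) => idx k ω := fun ω ω' h =>
    hx ω ω' fun k hk => congrFun h ⟨k, Finset.mem_range.2 hk⟩
  obtain ⟨F, hF⟩ := (Function.factorsThrough_iff (x n)).1 this
  exact ⟨F, congrFun hF⟩

variable {N : ℕ} {Ω : Type*} [MeasurableSpace Ω] {P : Measure Ω} [IsProbabilityMeasure P]
  {idx : ℕ → Ω → Fin N} {E : Type*} {x : ℕ → Ω → E}

/-- Functions of the index `idx n` and of an iterate determined by the earlier indices take finitely
many values. -/
lemma IsUniformSampling.integrable (hidx : IsUniformSampling P idx) [Nonempty E] {n : ℕ}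
    (hx : ∀ ω ω', (∀ k < n, idx k ω = idx k ω') → x n ω = x n ω') (h : Fin N → E → ℝ) :
    Integrable (fun ω => h (idx n ω) (x n ω)) P := by
  obtain ⟨F, hF⟩ := exists_factor_of_idx_eq hx
  have hT : Measurable fun ω => (idx n ω, fun k : Finset.range n => idx k ω) :=
    (hidx.measurable n).prodMk (measurable_pi_lambda _ fun k => hidx.measurable k)
  have h1 : Integrable (fun c : Fin N × (Finset.range n → Fin N) => h c.1 (F c.2))
    (P.map fun ω => (idx n ω, fun k : Finset.range n => idx k ω)) :=
    have := Measure.isProbabilityMeasure_map (μ := P) hT.aemeasurable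
    Integrable.of_finite
  refine (h1.comp_measurable hT).congr (Eventually.of_forall fun ω => ?_)
  simp [hF]

lemma IsUniformSampling.integrable_comp (hidx : IsUniformSampling P idx) [Nonempty E] {n : ℕ}
    (hx : ∀ ω ω', (∀ k < n, idx k ω = idx k ω') → x n ω = x n ω') (h : E → ℝ) :
    Integrable (fun ω => h (x n ω)) P :=
  hidx.integrable hx fun _ => h

/-- The index `idx n` is uniform and independent of the earlier indices. -/
lemma IsUniformSampling.integral_eq (hidx : IsUniformSampling P idx) [Nonempty E] {n : ℕ}
    (hx : ∀ ω ω', (∀ k < n, idx k ω = idx k ω') → x n ω = x n ω') (h : Fin N → E → ℝ) :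
    ∫ ω, h (idx n ω) (x n ω) ∂P = 1 / N * ∫ ω, ∑ i, h i (x n ω) ∂P := by
  obtain ⟨F, hF⟩ := exists_factor_of_idx_eq hx
  have hind : IndepFun (idx n) (fun ω (k : Finset.range n) => idx k ω) P := by
    have := hidx.indep.indepFun_finset {n} (Finset.range n) (by simp) hidx.measurable
    exact this.comp (φ := fun c : ({n} : Finset ℕ) → Fin N => c ⟨n, Finset.mem_singleton_self n⟩)
      (ψ := id) (measurable_pi_apply _) measurable_id
  have hi : ∀ i, ∫ ω, (if idx n ω = i then 1 else 0) * h i (x n ω) ∂P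
      = 1 / N * ∫ ω, h i (x n ω) ∂P := fun i => by
    have h1 := hind.comp (φ := fun k => if k = i then (1 : ℝ) else 0) (ψ := fun c => h i (F c))
      (Measurable.of_discrete) (Measurable.of_discrete)
    have hm1 : Measurable fun ω => if idx n ω = i then (1 : ℝ) else 0 :=
      (Measurable.of_discrete (f := fun k : Fin N => if k = i then (1 : ℝ) else 0)).comp
        (hidx.measurable n)
    have h2 := h1.integral_mul_eq_mul_integral hm1.aestronglyMeasurable
      ((Measurable.of_discrete (f := fun c => h i (F c))).comp
        (measurable_pi_lambda _ fun k => hidx.measurable k)).aestronglyMeasurable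
    have h3 : ∫ ω, (if idx n ω = i then (1 : ℝ) else 0) ∂P = 1 / N := by
      have hs : MeasurableSet {ω | idx n ω = i} := hidx.measurable n (measurableSet_singleton i)
      rw [← hidx.uniform n i, ← integral_indicator_one hs]
      exact integral_congr_ae (Eventually.of_forall fun ω => by simp [Set.indicator_apply])
    simp only [hF]
    simp only [Pi.mul_apply, Function.comp_apply] at h2
    rw [h2, h3]
  calc ∫ ω, h (idx n ω) (x n ω) ∂P
      = ∫ ω, ∑ i, (if idx n ω = i then 1 else 0) * h i (x n ω) ∂P := by simp
    _ = ∑ i, 1 / N * ∫ ω, h i (x n ω) ∂P := by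
      rw [integral_finsetSum _ fun i _ =>
        hidx.integrable hx fun k e => (if k = i then 1 else 0) * h i e]
      exact Finset.sum_congr rfl fun i _ => hi i
    _ = _ := by
      rw [integral_finsetSum _ fun i _ => hidx.integrable_comp hx (h i), Finset.mul_sum]

end Sampling

/-! ### Convergence of the expected Bregman distance -/

section Convergence

variable {X : Type*} [NormedAddCommGroup X] [NormedSpace ℝ X]
  {N : ℕ} {Y : Fin N → Type*} [∀ i, NormedAddCommGroup (Y i)] [∀ i, NormedSpace ℝ (Y i)]
  {s : ENNReal} {Ω : Type*} {p q : ℝ} {A : X →L[ℝ] PiLp s Y} {y : PiLp s Y}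
  {j : ∀ i, Y i → StrongDual ℝ (Y i)} {μ : ℕ → ℝ} {idx : ℕ → Ω → Fin N} {x₀ : X}
  {x : ℕ → Ω → X} {G c : ℝ} {xd : X}

lemma IsSGD.bregman_antitone (hx : IsSGD p q A y j μ idx x₀ x) (hpq : p.HolderConjugate q)
    (hsmooth : IsSmooth X) (hG : IsDualSmoothnessConst X q G)
    (hj : ∀ i, IsDualitySelection p (j i)) (hμ : ∀ k, 0 < μ k) (hA : A xd = y)
    (hstep : ∀ k, G * Lmax A ^ q * μ k ^ (q - 1) ≤ q) (ω : Ω) :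
    Antitone fun k => bregman p (x k ω) xd := by
  refine antitone_nat_of_succ_le fun k => ?_
  have h1 := hx.bregman_succ_le hpq hsmooth hG hj hμ hA k ω
  have h2 : G * Lmax A ^ q * μ k ^ (q - 1) / q ≤ 1 := (div_le_one hpq.symm.pos).2 (hstep k)
  have h3 : 0 ≤ μ k * (1 - G * Lmax A ^ q * μ k ^ (q - 1) / q)
      * ‖component A (idx k ω) (x k ω) - y (idx k ω)‖ ^ p :=
    mul_nonneg (mul_nonneg (hμ k).le (by linarith)) (by positivity)
  linarith

/-- The iterates stay in a ball, uniformly over the sample space. -/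
lemma IsSGD.exists_norm_sub_le (hx : IsSGD p q A y j μ idx x₀ x) (hpq : p.HolderConjugate q)
    (hsmooth : IsSmooth X) (hc : IsMidpointConvexityConst X p c)
    (hG : IsDualSmoothnessConst X q G)
    (hj : ∀ i, IsDualitySelection p (j i)) (hμ : ∀ k, 0 < μ k) (hA : A xd = y)
    (hstep : ∀ k, G * Lmax A ^ q * μ k ^ (q - 1) ≤ q) :
    ∃ M, 0 ≤ M ∧ ∀ k ω, ‖x k ω - xd‖ ≤ M := by
  have hc0 := hc.1
  have hp := hpq.pos
  have hB : 0 ≤ bregman p x₀ xd / (2 * c / p) :=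
    div_nonneg (bregman_nonneg hpq.lt _ _) (by positivity)
  refine ⟨(bregman p x₀ xd / (2 * c / p)) ^ p⁻¹, by positivity, fun k ω => ?_⟩
  have h1 := hx.bregman_antitone hpq hsmooth hG hj hμ hA hstep ω (Nat.zero_le k)
  simp only [hx.init] at h1
  have h2 := (hc.norm_sub_rpow_le_bregman hpq.lt (x k ω) xd).trans h1
  rw [Real.le_rpow_inv_iff_of_pos (norm_nonneg _) hB hp, le_div_iff₀ (by positivity)]
  linarith

variable [MeasurableSpace Ω] {P : Measure Ω} [IsProbabilityMeasure P]

/-- The expected descent inequality makes the weighted expected residuals summable. -/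
lemma IsSGD.summable_mul_integral_residualSum (hx : IsSGD p q A y j μ idx x₀ x)
    (hpq : p.HolderConjugate q) (hsmooth : IsSmooth X) (hG : IsDualSmoothnessConst X q G)
    (hj : ∀ i, IsDualitySelection p (j i)) (hμ : ∀ k, 0 < μ k)
    (hμsum : Summable fun k => μ k ^ q) (hA : A xd = y) (hidx : IsUniformSampling P idx) :
    Summable fun k => μ k * ∫ ω, residualSum p A y (x k ω) ∂P := by
  have hq := hpq.symm.pos
  have hfin := fun n => fun ω ω' => hx.eq_of_idx_eq hpq hG (ω := ω) (ω' := ω') n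
  have hN : (0 : ℝ) < N := by
    obtain ⟨ω⟩ := nonempty_of_isProbabilityMeasure P
    exact_mod_cast Fin.pos (idx 0 ω)
  have hS : ∀ k, 0 ≤ ∫ ω, residualSum p A y (x k ω) ∂P := fun k =>
    integral_nonneg fun ω => residualSum_nonneg _
  refine summable_of_eventually_le_mul_sub (C := 2 * N)
    (d := fun k => ∫ ω, bregman p (x k ω) xd ∂P) (by positivity)
    (fun k => mul_nonneg (hμ k).le (hS k))
    (fun k => integral_nonneg fun ω => bregman_nonneg hpq.lt _ _) ?_
  -- As `μ k → 0`, the factor in the descent inequality is eventually at least `1 / 2`.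
  have hlim : Tendsto (fun k => G * Lmax A ^ q * μ k ^ (q - 1) / q) atTop (𝓝 0) := by
    have h1 : Tendsto (fun k => (μ k ^ q) ^ ((q - 1) / q)) atTop (𝓝 0) := by
      have h0 : 0 < (q - 1) / q := div_pos hpq.symm.sub_one_pos hq
      have := hμsum.tendsto_atTop_zero.rpow_const (p := (q - 1) / q) (Or.inr h0.le)
      rwa [Real.zero_rpow h0.ne'] at this
    have h2 : ∀ k, (μ k ^ q) ^ ((q - 1) / q) = μ k ^ (q - 1) := fun k => by
      rw [← Real.rpow_mul (hμ k).le, mul_div_cancel₀ _ hq.ne']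
    simp only [h2] at h1
    simpa using (h1.const_mul (G * Lmax A ^ q)).div_const q
  filter_upwards [hlim.eventually_lt_const (by norm_num : (0 : ℝ) < 1 / 2)] with k hk
  set κ := 1 - G * Lmax A ^ q * μ k ^ (q - 1) / q with hκ
  have hD : ∀ k, Integrable (fun ω => bregman p (x k ω) xd) P := fun k =>
    hidx.integrable_comp (hfin k) fun u => bregman p u xd
  have hR : Integrable
      (fun ω => ‖component A (idx k ω) (x k ω) - y (idx k ω)‖ ^ p) P :=
    hidx.integrable (hfin k) fun i u => ‖component A i u - y i‖ ^ p
  have h1 : ∫ ω, bregman p (x (k + 1) ω) xd ∂P ≤ ∫ ω, (bregman p (x k ω) xd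
      - μ k * κ * ‖component A (idx k ω) (x k ω) - y (idx k ω)‖ ^ p) ∂P :=
    integral_mono (hD _) ((hD k).sub (hR.const_mul _)) fun ω =>
      hx.bregman_succ_le hpq hsmooth hG hj hμ hA k ω
  rw [integral_sub (hD k) (hR.const_mul _), integral_const_mul,
    hidx.integral_eq (hfin k) fun i u => ‖component A i u - y i‖ ^ p] at h1
  change _ ≤ _ - μ k * κ * (1 / N * ∫ ω, residualSum p A y (x k ω) ∂P) at h1
  have h2 : 1 / 2 * (μ k * (1 / N * ∫ ω, residualSum p A y (x k ω) ∂P))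
      ≤ κ * (μ k * (1 / N * ∫ ω, residualSum p A y (x k ω) ∂P)) :=
    mul_le_mul_of_nonneg_right (by linarith)
      (mul_nonneg (hμ k).le (mul_nonneg (by positivity) (hS k)))
  have h3 : μ k * ∫ ω, residualSum p A y (x k ω) ∂P
      = 2 * N * (1 / 2 * (μ k * (1 / N * ∫ ω, residualSum p A y (x k ω) ∂P))) := by
    field_simp
  rw [h3]
  refine mul_le_mul_of_nonneg_left ?_ (by positivity)
  linarith

/-- Convergence of the iterates to the minimum norm solution in expected Bregman distance. -/
theorem IsSGD.tendsto_integral_bregman [Fact (1 ≤ s)] [CompleteSpace X]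
    (hx : IsSGD p q A y j μ idx x₀ x)
    (hpq : p.HolderConjugate q) (hp2 : 2 ≤ p) (hsmooth : IsSmooth X)
    (hc : IsMidpointConvexityConst X p c) (hG : IsDualSmoothnessConst X q G)
    (hj : ∀ i, IsDualitySelection p (j i)) (hμ : ∀ k, 0 < μ k)
    (hμdiv : Tendsto (fun n => ∑ k ∈ Finset.range n, μ k) atTop atTop)
    (hμsum : Summable fun k => μ k ^ q) (hxd : IsMinNormSolution A y xd)
    (hx₀ : J p x₀ ∈ closure (Set.range (adjointMap A)))
    (hstep : ∀ k, G * Lmax A ^ q * μ k ^ (q - 1) ≤ q) (hidx : IsUniformSampling P idx) :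
    Tendsto (fun k => ∫ ω, bregman p (x k ω) xd ∂P) atTop (𝓝 0) := by
  have hp := hpq.lt
  have hA := hxd.1
  have hfin := fun n => fun ω ω' => hx.eq_of_idx_eq hpq hG (ω := ω) (ω' := ω') n
  have hD : ∀ k, Integrable (fun ω => bregman p (x k ω) xd) P := fun k =>
    hidx.integrable_comp (hfin k) fun u => bregman p u xd
  have hSint : ∀ k, Integrable (fun ω => residualSum p A y (x k ω)) P := fun k =>
    hidx.integrable_comp (hfin k) fun u => residualSum p A y u
  have hRint : ∀ k, Integrable
      (fun ω => ‖component A (idx k ω) (x k ω) - y (idx k ω)‖ ^ p) P := fun k =>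
    hidx.integrable (hfin k) fun i u => ‖component A i u - y i‖ ^ p
  set a : ℕ → ℝ := fun k => ∫ ω, residualSum p A y (x k ω) ∂P with ha
  have ha0 : ∀ k, 0 ≤ a k := fun k => integral_nonneg fun ω => residualSum_nonneg _
  have hRa : ∀ k, ∫ ω, ‖component A (idx k ω) (x k ω) - y (idx k ω)‖ ^ p ∂P ≤ a k := fun k =>
    integral_mono (hRint k) (hSint k) fun ω => rpow_residual_le_residualSum _ _
  have hsum : Summable fun k => μ k * a k :=
    hx.summable_mul_integral_residualSum hpq hsmooth hG hj hμ hμsum hA hidx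
  have hndiv : ¬ Summable μ := fun h =>
    not_tendsto_atTop_of_tendsto_nhds h.hasSum.tendsto_sum_nat hμdiv
  obtain ⟨M, hM0, hM⟩ := hx.exists_norm_sub_le hpq hsmooth hc hG hj hμ hA hstep
  have hres : ∀ k ω i, ‖component A i (x k ω) - y i‖ ≤ ‖A‖ * M := fun k ω i => by
    rw [← component_sub_of_solution hA]
    refine (norm_component_apply_le _ i).trans ((A.le_opNorm _).trans ?_)
    gcongr
    exact hM k ω
  have hest : ∀ ε > 0, ∃ n, ∫ ω, bregman p (x n ω) xd ∂P ≤ (5 + M) * ε := by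
    intro ε hε
    obtain ⟨C₁, hC₁, h₁⟩ := hxd.exists_norm_rpow_le hp2 hc hε
    obtain ⟨m, hm⟩ := exists_sum_Ico_le hsum hε
    obtain ⟨C₂, hC₂, h₂⟩ := hx.exists_abs_J_apply_le hpq hsmooth hj hμ hx₀
      (by positivity : 0 ≤ ‖A‖ * M) hres hε m
    obtain ⟨C₃, hC₃, h₃⟩ := exists_mul_norm_residual_le A y hp.le hC₂ hε
    -- At `n` the expected residual is small and no larger than at any index in `[m, n)`.
    obtain ⟨n, hmn, hn, hmin⟩ := exists_le_and_forall_le (fun k => (hμ k).le) hndiv hsum m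
      (by positivity : 0 < ε / (C₁ + C₃ + 1))
    refine ⟨n, ?_⟩
    have hpt : ∀ ω, bregman p (x n ω) xd ≤ (2 * ε + M * ε)
        + (C₁ + C₃) * residualSum p A y (x n ω)
        + ∑ l ∈ Finset.Ico m n, μ l * (‖component A (idx l ω) (x l ω) - y (idx l ω)‖ ^ p
          + residualSum p A y (x n ω)) := by
      intro ω
      have e1 : ‖xd‖ ^ p / p - ‖x n ω‖ ^ p / p ≤ ε + C₁ * residualSum p A y (x n ω) := by
        rw [← sub_div, div_le_iff₀ (by linarith)]
        have t1 := h₁ (x n ω)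
        have t2 : 0 ≤ ε + C₁ * residualSum p A y (x n ω) :=
          add_nonneg hε.le (mul_nonneg hC₁ (residualSum_nonneg _))
        have t3 := le_mul_of_one_le_right t2 hp.le
        linarith
      have e2 := hx.J_sub_J_apply_le hpq hsmooth hj hμ hA hmn ω
      have e3 := (le_abs_self _).trans (h₂ ω (x n ω - xd))
      have e4 := h₃ (x n ω)
      have e5 : ε * ‖x n ω - xd‖ ≤ M * ε := by
        rw [mul_comm]
        gcongr
        exact hM n ω
      rw [map_sub A, hA] at e3
      rw [sub_apply] at e2
      have e6 : bregman p (x n ω) xd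
          = ‖xd‖ ^ p / p - ‖x n ω‖ ^ p / p + J p (x n ω) (x n ω - xd) := by
        rw [bregman_eq hp, map_sub, map_sub]
        ring
      rw [e6]
      linarith
    have hsumint : ∀ l ∈ Finset.Ico m n, Integrable (fun ω => μ l *
        (‖component A (idx l ω) (x l ω) - y (idx l ω)‖ ^ p + residualSum p A y (x n ω))) P :=
      fun l _ => ((hRint l).add (hSint n)).const_mul _
    have haddint : Integrable (fun ω => (2 * ε + M * ε)
        + (C₁ + C₃) * residualSum p A y (x n ω)) P :=
      (integrable_const _).add ((hSint n).const_mul _)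
    have hint := (integral_mono (hD n) (haddint.add (integrable_finsetSum _ hsumint)) hpt).trans_eq
      (integral_add haddint (integrable_finsetSum _ hsumint))
    have hval : ∫ ω, ∑ l ∈ Finset.Ico m n, μ l *
        (‖component A (idx l ω) (x l ω) - y (idx l ω)‖ ^ p + residualSum p A y (x n ω)) ∂P
        = ∑ l ∈ Finset.Ico m n,
          μ l * (∫ ω, ‖component A (idx l ω) (x l ω) - y (idx l ω)‖ ^ p ∂P + a n) := by
      rw [integral_finsetSum _ hsumint]
      refine Finset.sum_congr rfl fun l _ => ?_
      rw [integral_const_mul, integral_add (hRint l) (hSint n)]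
    have hterm : ∑ l ∈ Finset.Ico m n,
        μ l * (∫ ω, ‖component A (idx l ω) (x l ω) - y (idx l ω)‖ ^ p ∂P + a n)
        ≤ ∑ l ∈ Finset.Ico m n, 2 * (μ l * a l) := by
      refine Finset.sum_le_sum fun l hl => ?_
      have t1 := mul_le_mul_of_nonneg_left (add_le_add (hRa l) (hmin l hl)) (hμ l).le
      linarith
    rw [← Finset.mul_sum] at hterm
    have hm' := hm n hmn
    have hsmall : (C₁ + C₃) * a n ≤ ε := by
      rw [le_div_iff₀ (by positivity)] at hn
      have := ha0 n
      linarith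
    rw [hval, integral_add (integrable_const _) ((hSint n).const_mul _), integral_const,
      integral_const_mul, probReal_univ, one_smul] at hint
    linarith
  refine tendsto_zero_of_antitone (fun k l hkl => integral_mono (hD l) (hD k) fun ω =>
    hx.bregman_antitone hpq hsmooth hG hj hμ hA hstep ω hkl)
    (fun k => integral_nonneg fun ω => bregman_nonneg hp _ _) fun ε hε => ?_
  obtain ⟨n, hn⟩ := hest (ε / (5 + M)) (by positivity)
  exact ⟨n, hn.trans (le_of_eq (mul_div_cancel₀ _ (by positivity)))⟩

/-- Domination up to arbitrarily small constants transfers convergence of expectations to `0`. -/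
lemma tendsto_integral_zero_of_forall_le {f g : ℕ → Ω → ℝ} (hf0 : ∀ k ω, 0 ≤ f k ω)
    (hf : ∀ k, Integrable (f k) P) (hg : ∀ k, Integrable (g k) P)
    (hlim : Tendsto (fun k => ∫ ω, g k ω ∂P) atTop (𝓝 0))
    (h : ∀ ε > 0, ∃ C, 0 ≤ C ∧ ∀ k ω, f k ω ≤ ε + C * g k ω) :
    Tendsto (fun k => ∫ ω, f k ω ∂P) atTop (𝓝 0) := by
  rw [Metric.tendsto_atTop]
  intro ε hε
  obtain ⟨C, hC, hle⟩ := h (ε / 2) (by positivity)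
  obtain ⟨n, hn⟩ := eventually_atTop.1
    (hlim.eventually_lt_const (by positivity : 0 < ε / 2 / (C + 1)))
  refine ⟨n, fun k hk => ?_⟩
  rw [Real.dist_eq, sub_zero, abs_of_nonneg (integral_nonneg (hf0 k))]
  have h1 := integral_mono (hf k) ((integrable_const (ε / 2)).add ((hg k).const_mul C)) (hle k)
  simp only [Pi.add_apply] at h1
  rw [integral_add (integrable_const _) ((hg k).const_mul _), integral_const, integral_const_mul,
    probReal_univ, one_smul] at h1
  have h2 := hn k hk
  rw [lt_div_iff₀ (by positivity)] at h2
  rcases le_or_gt 0 (∫ ω, g k ω ∂P) with h3 | h3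
  · linarith
  · have := mul_nonneg_of_nonpos_of_nonpos (neg_nonpos.2 hC) h3.le
    linarith

end Convergence

end BanachSGD

theorem theorem3p8
    {X : Type*} [NormedAddCommGroup X] [NormedSpace ℝ X] [CompleteSpace X]
    {N : ℕ} {Y : Fin N → Type*} [∀ i, NormedAddCommGroup (Y i)] [∀ i, NormedSpace ℝ (Y i)]
    [∀ i, CompleteSpace (Y i)]
    {s : ENNReal} [Fact (1 ≤ s)]
    {Ω : Type*} [MeasurableSpace Ω] (P : Measure Ω) [IsProbabilityMeasure P]
    (p q : ℝ) (hpq : p.HolderConjugate q) (hp2 : 2 ≤ p)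
    (hconv : BanachSGD.IsPConvex X p) (hsmooth : BanachSGD.IsSmooth X)
    (A : X →L[ℝ] PiLp s Y) (y : PiLp s Y)
    (xdag : X) (hxdag : BanachSGD.IsMinNormSolution A y xdag)
    (j : ∀ i, Y i → StrongDual ℝ (Y i)) (hj : ∀ i, BanachSGD.IsDualitySelection p (j i))
    (μ : ℕ → ℝ) (hμpos : ∀ k, 0 < μ k)
    (hμdiv : Tendsto (fun n => ∑ k ∈ Finset.range n, μ k) atTop atTop)
    (hμsum : Summable (fun k => μ k ^ q))
    (idx : ℕ → Ω → Fin N) (hidx : BanachSGD.IsUniformSampling P idx)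
    (x₀ : X)
    (hx₀ : BanachSGD.J p x₀ ∈ closure (Set.range (BanachSGD.adjointMap A)))
    (x : ℕ → Ω → X) (hx : BanachSGD.IsSGD p q A y j μ idx x₀ x) :
    (∃ G : ℝ, BanachSGD.IsDualSmoothnessConst X q G) ∧
    ∀ G : ℝ, BanachSGD.IsDualSmoothnessConst X q G →
      (∀ k, G * BanachSGD.Lmax A ^ q * μ k ^ (q - 1) ≤ q) →
      ((∀ k, Integrable (fun ω => BanachSGD.bregman p (x k ω) xdag) P) ∧
        Tendsto (fun k => ∫ ω, BanachSGD.bregman p (x k ω) xdag ∂P) atTop (𝓝 0)) ∧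
      (∀ r : ℝ, 1 ≤ r → r ≤ p →
        (∀ k, Integrable (fun ω => ‖x k ω - xdag‖ ^ r) P) ∧
        Tendsto (fun k => ∫ ω, ‖x k ω - xdag‖ ^ r ∂P) atTop (𝓝 0)) ∧
      (BanachSGD.IsUniformlySmooth X →
        (∀ k, Integrable
          (fun ω => ‖BanachSGD.J p (x k ω) - BanachSGD.J p xdag‖ ^ q) P) ∧
        Tendsto (fun k => ∫ ω, ‖BanachSGD.J p (x k ω) - BanachSGD.J p xdag‖ ^ q ∂P)
          atTop (𝓝 0)) := by
  obtain ⟨c, hc⟩ := hconv.exists_midpointConvexityConst hp2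
  refine ⟨hc.exists_dualSmoothnessConst hpq, fun G hG hstep => ?_⟩
  have hp := hpq.lt
  have hc0 := hc.1
  have hq := hpq.symm.pos
  have hfin := fun n => fun ω ω' => hx.eq_of_idx_eq hpq hG (ω := ω) (ω' := ω') n
  have hint : ∀ (h : X → ℝ) (k : ℕ), Integrable (fun ω => h (x k ω)) P := fun h k =>
    hidx.integrable_comp (hfin k) h
  have hD := hx.tendsto_integral_bregman hpq hp2 hsmooth hc hG hj hμpos hμdiv hμsum hxdag hx₀
    hstep hidx
  have hdist : Tendsto (fun k => ∫ ω, ‖x k ω - xdag‖ ^ p ∂P) atTop (𝓝 0) := by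
    refine BanachSGD.tendsto_integral_zero_of_forall_le (fun k ω => by positivity)
      (hint fun u => ‖u - xdag‖ ^ p) (hint fun u => BanachSGD.bregman p u xdag) hD
      fun ε hε => ⟨(2 * c / p)⁻¹, by positivity, fun k ω => ?_⟩
    have h1 := hc.norm_sub_rpow_le_bregman hp (x k ω) xdag
    have h2 : ‖x k ω - xdag‖ ^ p ≤ (2 * c / p)⁻¹ * BanachSGD.bregman p (x k ω) xdag := by
      rwa [← div_eq_inv_mul, le_div_iff₀' (by positivity)]
    linarith
  refine ⟨⟨hint fun u => BanachSGD.bregman p u xdag, hD⟩, fun r hr hrp =>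
    ⟨hint fun u => ‖u - xdag‖ ^ r, ?_⟩, fun hX =>
    ⟨hint fun u => ‖BanachSGD.J p u - BanachSGD.J p xdag‖ ^ q, ?_⟩⟩
  · refine BanachSGD.tendsto_integral_zero_of_forall_le (fun k ω => by positivity)
      (hint fun u => ‖u - xdag‖ ^ r) (hint fun u => ‖u - xdag‖ ^ p) hdist fun ε hε => ?_
    obtain ⟨C, hC, h⟩ := BanachSGD.exists_rpow_le_add_mul_rpow (by linarith : 0 < r) hrp hε
    exact ⟨C, hC, fun k ω => h _ (norm_nonneg _)⟩
  · refine BanachSGD.tendsto_integral_zero_of_forall_le (fun k ω => by positivity)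
      (hint fun u => ‖BanachSGD.J p u - BanachSGD.J p xdag‖ ^ q) (hint fun u => ‖u - xdag‖ ^ p)
      hdist fun ε hε => ?_
    obtain ⟨M, hM0, hM⟩ := hx.exists_norm_sub_le hpq hsmooth hc hG hj hμpos hxdag.1 hstep
    -- Near `xdag` use continuity of the duality map; elsewhere it is bounded on the iterates.
    have hcont : Tendsto (fun u => ‖BanachSGD.J p u - BanachSGD.J p xdag‖ ^ q) (𝓝 xdag) (𝓝 0) := by
      have := (((hX.continuous_J hp).tendsto xdag).sub_const (BanachSGD.J p xdag)).norm.rpow_const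
        (p := q) (Or.inr hq.le)
      rwa [sub_self, norm_zero, Real.zero_rpow hq.ne'] at this
    obtain ⟨δ, hδ, hball⟩ := Metric.eventually_nhds_iff.1 (hcont.eventually_lt_const hε)
    set B : ℝ := ((M + ‖xdag‖) ^ (p - 1) + ‖xdag‖ ^ (p - 1)) ^ q with hB
    refine ⟨B / δ ^ p, by positivity, fun k ω => ?_⟩
    rcases lt_or_ge ‖x k ω - xdag‖ δ with h | h
    · have h1 := hball (by rwa [dist_eq_norm] : dist (x k ω) xdag < δ)
      have h2 : 0 ≤ B / δ ^ p * ‖x k ω - xdag‖ ^ p := by positivity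
      linarith
    · have hnorm : ‖x k ω‖ ≤ M + ‖xdag‖ := by
        have h1 := norm_le_norm_sub_add (x k ω) xdag
        have h2 := hM k ω
        linarith
      have hJ : ‖BanachSGD.J p (x k ω) - BanachSGD.J p xdag‖ ^ q ≤ B := by
        refine Real.rpow_le_rpow (norm_nonneg _) ((norm_sub_le _ _).trans ?_) hq.le
        rw [BanachSGD.norm_of_mem_dualityMap (BanachSGD.J_mem_dualityMap hp _),
          BanachSGD.norm_of_mem_dualityMap (BanachSGD.J_mem_dualityMap hp _)]
        have := hpq.sub_one_pos.le
        gcongr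
      have h2 : B ≤ B / δ ^ p * ‖x k ω - xdag‖ ^ p := by
        rw [div_mul_eq_mul_div, le_div_iff₀ (by positivity)]
        gcongr
      linarith
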